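/- Let $n$ be a natural number and let $\Omega$ be a set of $3n$ points. Let $\{I, A_1, A_2, A_3\}$ be a homogeneous coherent configuration of rank $4$ on $\Omega$, given by the adjacency matrices of its relations: $I, A_1, A_2, A_3$ are non-zero $0$-$1$ matrices indexed by $\Omega$ whose sum is the all-one matrix, the set $\{I,A_1,A_2,A_3\}$ is closed under transposition, and every product of two of these matrices is a linear combination of the four with non-negative integer coefficients. Suppose that the configuration is primitive, that is, that the graph of each of the relations $A_1, A_2, A_3$ is connected. Suppose that for each $i \in \{1,2,3\}$ the matrix $A_i$ has eigenvalues $k_i, r_i, s_i, t_i \in \mathbb{C}$ with multiplicities $1, n, n, n-1$ respectively (where multiplicities are added up if some of these numbers coincide); in other words, $$\det(XI - A_i) = (X-k_i)(X-r_i)^n(X-s_i)^n(X-t_i)^{n-1}.$$ Then, after a suitable renumbering of $A_1, A_2, A_3$, there is a non-negative integer $a$ with $n = 3a^2+3a+1$ such that one of the following holds: 1. $A_2 = A_3^{\top}$, the integer $a$ is even, and the row sums of $A_1, A_2, A_3$ are $n-2a-1$, $n+a$, $n+a$ respectively; 2. $A_2 = A_3^{\top}$, the integer $a$ is odd, and the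 row sums of $A_1, A_2, A_3$ are $n+2a+1$, $n-a-1$, $n-a-1$ respectively; 3. all the matrices are symmetric, and the row sums of $A_1, A_2, A_3$ are $n+2a+1$, $n-a-1$, $n-a-1$ respectively. -/

import Mathlib

open Polynomial

/-- A coherent configuration on the finite set `Ω`, given by the adjacency matrices
`A i` (`i : ι`) of its relations; its rank is the number of elements of `ι`. -/
structure IsCoherentConfiguration {Ω ι : Type*} [Fintype Ω] [DecidableEq Ω] [Fintype ι]
    (A : ι → Matrix Ω Ω ℂ) : Prop where
  /-- every `A i` is the adjacency matrix of a relation -/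
  zero_one : ∀ i x y, A i x y = 0 ∨ A i x y = 1
  /-- the relations are the blocks of a partition, hence non-empty (and so distinct) -/
  ne_zero : ∀ i, A i ≠ 0
  /-- the matrices sum to the all-one matrix: the relations partition `Ω × Ω` -/
  sum_eq : ∑ i, A i = Matrix.of (fun _ _ => 1)
  /-- some of the relations partition the diagonal -/
  diagonal : ∃ S : Finset ι, ∑ i ∈ S, A i = 1
  /-- the converse of a relation of the configuration is one of its relations -/
  transpose : ∀ i, ∃ j, (A i).transpose = A j
  /-- the products are combinations with the intersection numbers as coefficients -/
  mul : ∀ i j, ∃ p : ι → ℕ, A i * A j = ∑ k, (p k : ℂ) • A k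

/-- The undirected graph on `Ω` that underlies the relation with adjacency matrix `M`. -/
def relationGraph {Ω : Type*} (M : Matrix Ω Ω ℂ) : SimpleGraph Ω :=
  SimpleGraph.fromRel (fun x y => M x y = 1)

/-- A homogeneous configuration is primitive if each of its relations other than the
diagonal is connected. -/
def IsPrimitiveConfiguration {Ω ι : Type*} [DecidableEq Ω] (A : ι → Matrix Ω Ω ℂ) : Prop :=
  ∀ i, A i ≠ 1 → (relationGraph (A i)).Connected

/-- The complex matrix `M` has eigenvalues `k, r, s, t` with (algebraic) multiplicities
`1, n, n, n - 1`; multiplicities are added up if some of the four numbers coincide. -/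
def HasMultiplicities {Ω : Type*} [Fintype Ω] [DecidableEq Ω]
    (M : Matrix Ω Ω ℂ) (n : ℕ) (k r s t : ℂ) : Prop :=
  M.charpoly = (X - C k) * (X - C r) ^ n * (X - C s) ^ n * (X - C t) ^ (n - 1)

/-- All row sums of `M` are equal to the integer `k`. -/
def HasRowSum {Ω : Type*} [Fintype Ω] (M : Matrix Ω Ω ℂ) (k : ℤ) : Prop :=
  ∀ x, ∑ y, M x y = (k : ℂ)

/-!
The adjacency algebra of the configuration is commutative: the trilinear form `trace (X * Y * Z)`
is symmetric on the basis `A`, because `A 1`, `A 2`, `A 3` and the identity add up to the all-one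
matrix (`mul_comm_of_rank_four`). It is closed under conjugate transposition, hence reduced, and so
isomorphic to `ℂ ^ 4` (`exists_spectralDecomposition`). The four characters have multiplicities
whose partial sums are the multiplicities of the eigenvalues of each `A i`; comparing these for the
three relations shows that the characters themselves have multiplicities `1, n, n, n - 1`
(`multiplicities_of_characters`). This needs `3 ≤ n`, which holds because a connected relation of
valency `1` would make every valency `1`.

The values `t i` of the character of multiplicity `n - 1` are integers, since no conjugate of `t i`
can have the same multiplicity (`exists_int_character`). The trace gives `k i - t i = n * v i` with
integers `v i`, which are positive because connectedness makes the valency `k i` a simple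
eigenvalue, and which add up to `3`. Hence `t i = k i - n`, and the other two eigenvalues satisfy
`r i + s i = n - 1 - k i`. Expanding the idempotent of rank `n - 1` in the basis `A` gives
`1 / k 1 + 1 / k 2 + 1 / k 3 = 3 / (n - 1)` (`exists_eigenvalues`).

If some relation is not symmetric, two valencies are `n + x` and the third is `n - 1 - 2 * x`. The
harmonic relation becomes `n = 3 * x ^ 2 + 3 * x + 1`, and the trace of the cube of an antisymmetric
relation shows that `(x + 2) * (2 * x + 1)` is even, so that `x` is even. The first two alternatives
are `x = a` and `x = -a - 1`.

If all relations are symmetric, the traces of the squares and cubes express the intersection numbers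
`p i = p_{ii}^i` by `n` and the valencies. In coordinates `n = 2 * l + 1`, `k i = 2 * (l + v i)`,
the integers `18 * p i + 12 * l - 24 * v i + 9 + 48 * e₂(v)` have second elementary symmetric
function `-3 * (1 + 8 * y) * τ / Q`, where `Q` is quadratic in `τ`, and `τ * Q` is a multiple of the
discriminant of the `v i`. For `τ ≠ 0` this quotient is too small to be a non-zero integer, up to
one exception that is checked by hand, and for `τ = 0` two of the `v i` coincide, which is impossible
modulo `2` (`false_of_integral_parameters`). So the symmetric alternative does not occur.
-/

/-! ### The Diophantine problem behind the symmetric case -/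

/-- Two of the `v i` coincide: then `l = 6 * v ^ 2 - 3 * v` for the repeated value `v`, and the
integrality condition fails modulo `2`. -/
lemma false_of_repeated_value {l u v p : ℤ} (hl : 0 < l) (hs : u + v + v = 1)
    (hR : l ^ 2 + 2 * l * (u * v + u * v + v * v) + 3 * (u * v * v) = 0)
    (hD : 0 < l + v)
    (hp : 3 * p * (l + v) = (l + v) * (2 * l - 2 * v - 1) + v * (4 * v - 1) * (3 * v - 1)) :
    False := by
  obtain rfl : u = 1 - 2 * v := by linarith
  have h1 : (l + v) * (l - (6 * v ^ 2 - 3 * v)) = 0 := by linear_combination hR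
  have h2 : l = 6 * v ^ 2 - 3 * v := by
    rcases mul_eq_zero.mp h1 with h | h <;> linarith
  subst h2
  have h3 : v * (3 * v - 1) ≠ 0 := by
    intro h
    have : 6 * v ^ 2 - 3 * v + v = 2 * (v * (3 * v - 1)) := by ring
    rw [this, h] at hD
    simp at hD
  have h4 : 2 * (3 * p - (2 * (6 * v ^ 2 - 3 * v) - 2 * v - 1)) = 4 * v - 1 := by
    apply mul_left_cancel₀ h3
    linear_combination hp
  omega

/-- The quotient bound `Q ≤ 3 * |1 + 8 * y| * τ` and the divisibility leave, in the residue
class `y ≡ 1 [ZMOD 3]`, only one pair `(y, τ)`. -/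
lemma eq_of_quotient_dvd {y τ : ℤ} (hτ : 0 < τ) (hy : y % 3 = 1)
    (hQ : 0 < 4 * (y ^ 2 + τ) ^ 2 - 4 * (y ^ 2 + τ) * y - τ)
    (hdvd : 4 * (y ^ 2 + τ) ^ 2 - 4 * (y ^ 2 + τ) * y - τ ∣ 3 * (1 + 8 * y) * τ) :
    y = 1 ∧ τ = 6 := by
  have hne : 3 * (1 + 8 * y) * τ ≠ 0 := by
    refine mul_ne_zero (by omega) hτ.ne'
  have hle := Int.le_of_dvd (abs_pos.mpr hne) ((dvd_abs _ _).mpr hdvd)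
  rw [abs_mul, abs_of_pos hτ] at hle
  have hy1 : y = 1 := by
    rcases le_or_gt 4 y with h | h
    · rw [abs_of_pos (by linarith)] at hle
      exfalso
      have e1 : 0 < y ^ 3 * (y - 1) := by
        have : 0 < y - 1 := by linarith
        have : 0 < y := by linarith
        positivity
      have e2 : 0 ≤ τ * (y * (2 * y - 7)) :=
        mul_nonneg hτ.le (mul_nonneg (by linarith) (by linarith))
      have e3 : 0 ≤ τ * (τ - 1) := mul_nonneg hτ.le (by linarith)
      linarith [show 4 * (y ^ 2 + τ) ^ 2 - 4 * (y ^ 2 + τ) * y - τ - 3 * ((1 + 8 * y) * τ) =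
        4 * (y ^ 3 * (y - 1)) + 4 * (τ * (y * (2 * y - 7))) + 4 * (τ * (τ - 1)) by ring]
    · rcases le_or_gt y (-2) with h' | h'
      · rw [abs_of_neg (by linarith)] at hle
        exfalso
        have e1 : 0 < y ^ 3 * (y - 1) :=
          mul_pos_of_neg_of_neg (Odd.pow_neg (by decide) (by linarith)) (by linarith)
        have e2 : 0 ≤ τ * (-(y + 2)) := mul_nonneg hτ.le (by linarith)
        have e3 : 0 ≤ τ * (y + 2) ^ 2 := mul_nonneg hτ.le (sq_nonneg _)
        have e4 := sq_nonneg (τ - 1)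
        linarith [show 4 * (y ^ 2 + τ) ^ 2 - 4 * (y ^ 2 + τ) * y - τ - -(3 * (1 + 8 * y)) * τ =
          4 * (y ^ 3 * (y - 1)) + 8 * (τ * (y + 2) ^ 2) + 12 * (τ * (-(y + 2)))
            + (4 * (τ - 1) ^ 2 + 2 * τ - 4) by ring]
      · omega
  refine ⟨hy1, ?_⟩
  subst hy1
  have hd : τ * (4 * τ + 3) ∣ τ * 27 := by
    convert hdvd using 1 <;> ring
  have hd' := Int.dvd_of_mul_dvd_mul_left hτ.ne' hd
  have := Int.le_of_dvd (by norm_num) hd'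
  have h6 : τ ≤ 6 := by omega
  interval_cases τ <;> omega

/-- The parameters `l + u`, `l + v`, `l + w` of a symmetric configuration (half the valencies, with
the harmonic relation `hR`) are not compatible with the integrality of `p`, `q`, `r`.

The integers `a`, `b`, `c` below are chosen such that `a * b + a * c + b * c` is the quotient of
`-3 * (1 + 8 * y) * τ` by the much larger `Q`. -/
lemma false_of_integral_parameters {l u v w p q r : ℤ} (hl : 0 < l) (hs : u + v + w = 1)
    (hR : l ^ 2 + 2 * l * (u * v + u * w + v * w) + 3 * (u * v * w) = 0)
    (hu : 0 < l + u) (hv : 0 < l + v) (hw : 0 < l + w)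
    (hp : 3 * p * (l + u) = (l + u) * (2 * l - 2 * u - 1) + u * (4 * u - 1) * (3 * u - 1))
    (hq : 3 * q * (l + v) = (l + v) * (2 * l - 2 * v - 1) + v * (4 * v - 1) * (3 * v - 1))
    (hr : 3 * r * (l + w) = (l + w) * (2 * l - 2 * w - 1) + w * (4 * w - 1) * (3 * w - 1)) :
    False := by
  obtain ⟨e, he⟩ : ∃ e, e = u * v + u * w + v * w := ⟨_, rfl⟩
  obtain ⟨y, hy⟩ : ∃ y, y = 1 - 6 * e - 3 * l := ⟨_, rfl⟩
  obtain ⟨τ, hτ⟩ : ∃ τ, τ = 1 - 3 * e - y ^ 2 := ⟨_, rfl⟩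
  obtain ⟨Q, hQ⟩ : ∃ Q, Q = 4 * (y ^ 2 + τ) ^ 2 - 4 * (y ^ 2 + τ) * y - τ := ⟨_, rfl⟩
  have hw' : w = 1 - u - v := by omega
  -- `Q` is three times the second elementary symmetric function of the halved valencies
  have hQ' : Q = 3 * ((l + u) * (l + v) + (l + u) * (l + w) + (l + v) * (l + w)) := by
    rw [hQ, hτ, hy, he, hw']; ring
  have hQpos : 0 < Q := by rw [hQ']; positivity
  have hprod : 9 * ((l + u) * (l + v) * (l + w)) = l * Q := by
    rw [hQ', hw']; rw [hw'] at hR; linear_combination 3 * hR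
  -- the discriminant of the cubic with roots `u, v, w`
  have hdisc : 27 * ((u - v) * (u - w) * (v - w)) ^ 2 = τ * Q := by
    have : 27 * ((u - v) * (u - w) * (v - w)) ^ 2 - τ * Q =
        (-243 * (u * v * w) + 162 * e - 36 + 81 * l ^ 2 + 162 * l * e) *
        (l ^ 2 + 2 * l * (u * v + u * w + v * w) + 3 * (u * v * w)) := by
      rw [hQ', hτ, hy, he, hw']; ring
    rw [hR] at this; linear_combination this
  have hτ0 : 0 ≤ τ := by
    have h : 0 ≤ τ * Q := hdisc ▸ mul_nonneg (by norm_num) (sq_nonneg _)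
    exact nonneg_of_mul_nonneg_left h hQpos
  rcases hτ0.eq_or_lt with h0 | hτpos
  · rw [← h0, zero_mul] at hdisc
    have h1 : (u - v) * (u - w) * (v - w) = 0 := by
      have := (mul_eq_zero.mp hdisc).resolve_left (by norm_num)
      exact pow_eq_zero_iff (two_ne_zero) |>.mp this
    rcases mul_eq_zero.mp h1 with h | h
    · rcases mul_eq_zero.mp h with h | h
      · obtain rfl : u = v := sub_eq_zero.mp h
        exact false_of_repeated_value (u := w) hl (by omega) (by linear_combination hR) hu hp
      · obtain rfl : u = w := sub_eq_zero.mp h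
        exact false_of_repeated_value (u := v) hl (by omega) (by linear_combination hR) hu hp
    · obtain rfl : v = w := sub_eq_zero.mp h
      exact false_of_repeated_value (u := u) hl (by omega) (by linear_combination hR) hv hq
  obtain ⟨a, ha⟩ : ∃ a, a = 18 * p + 12 * l - 24 * u + 9 + 48 * e := ⟨_, rfl⟩
  obtain ⟨b, hb⟩ : ∃ b, b = 18 * q + 12 * l - 24 * v + 9 + 48 * e := ⟨_, rfl⟩
  obtain ⟨c, hc⟩ : ∃ c, c = 18 * r + 12 * l - 24 * w + 9 + 48 * e := ⟨_, rfl⟩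
  have hNa : a * (l + u) = (l + u) * (24 * l - 36 * u + 3 + 48 * e)
      + 6 * u * (4 * u - 1) * (3 * u - 1) := by rw [ha]; linear_combination 6 * hp
  have hNb : b * (l + v) = (l + v) * (24 * l - 36 * v + 3 + 48 * e)
      + 6 * v * (4 * v - 1) * (3 * v - 1) := by rw [hb]; linear_combination 6 * hq
  have hNc : c * (l + w) = (l + w) * (24 * l - 36 * w + 3 + 48 * e)
      + 6 * w * (4 * w - 1) * (3 * w - 1) := by rw [hc]; linear_combination 6 * hr
  have hsym : 3 * ((a * b + a * c + b * c) * ((l + u) * (l + v) * (l + w)))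
      = - (l * (1 + 8 * y) * τ) := by
    have h1 : (a * b + a * c + b * c) * ((l + u) * (l + v) * (l + w)) =
        (a * (l + u)) * (b * (l + v)) * (l + w) + (a * (l + u)) * (c * (l + w)) * (l + v)
        + (b * (l + v)) * (c * (l + w)) * (l + u) := by ring
    rw [h1, hNa, hNb, hNc]
    clear hNa hNb hNc h1 ha hb hc
    have : 3 * (((l + u) * (24 * l - 36 * u + 3 + 48 * e) + 6 * u * (4 * u - 1) * (3 * u - 1)) *
          ((l + v) * (24 * l - 36 * v + 3 + 48 * e) + 6 * v * (4 * v - 1) * (3 * v - 1)) * (l + w) +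
        ((l + u) * (24 * l - 36 * u + 3 + 48 * e) + 6 * u * (4 * u - 1) * (3 * u - 1)) *
          ((l + w) * (24 * l - 36 * w + 3 + 48 * e) + 6 * w * (4 * w - 1) * (3 * w - 1)) * (l + v) +
        ((l + v) * (24 * l - 36 * v + 3 + 48 * e) + 6 * v * (4 * v - 1) * (3 * v - 1)) *
          ((l + w) * (24 * l - 36 * w + 3 + 48 * e) + 6 * w * (4 * w - 1) * (3 * w - 1)) * (l + u))
        + l * (1 + 8 * y) * τ =
        (15552 * l * (u * v * w) + 6480 * (u * v * w) - 1728 * e ^ 2 + 10368 * l ^ 2 * e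
          + 1296 * l * e - 108 * e + 5184 * l ^ 3 + 1512 * l ^ 2 + 504 * l + 135) *
        (l ^ 2 + 2 * l * (u * v + u * w + v * w) + 3 * (u * v * w)) := by
      rw [hτ, hy, he, hw']; ring
    rw [hR] at this; linear_combination this
  have hdvd : (a * b + a * c + b * c) * Q = - (3 * (1 + 8 * y) * τ) := by
    apply mul_left_cancel₀ hl.ne'
    linear_combination 3 * hsym - (a * b + a * c + b * c) * hprod
  obtain ⟨hy1, hτ6⟩ := eq_of_quotient_dvd hτpos (by omega) (hQ ▸ hQpos)
    (hQ ▸ (dvd_neg.mp ⟨a * b + a * c + b * c, by rw [← hdvd, mul_comm]⟩))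
  -- here `{u, v, w} = {-1, 0, 2}` and `l = 4`
  have he2 : e = -2 := by rw [hy1, hτ6] at hτ; omega
  have hl4 : l = 4 := by omega
  have h3 : u * v * w = 0 := by rw [← he, he2, hl4] at hR; omega
  have key : ∀ {z s : ℤ}, z * (z - 2) * (z + 1) = 0 →
      3 * s * (l + z) = (l + z) * (2 * l - 2 * z - 1) + z * (4 * z - 1) * (3 * z - 1) →
      z = 0 ∨ z = 2 := by
    intro z s hz hs
    rcases mul_eq_zero.mp hz with h | h
    · rcases mul_eq_zero.mp h with h | h
      · exact Or.inl h
      · exact Or.inr (by omega)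
    · exfalso
      obtain rfl : z = -1 := by omega
      rw [hl4] at hs
      omega
  have hroot : ∀ z, z ^ 3 - (u + v + w) * z ^ 2 + (u * v + u * w + v * w) * z - u * v * w = 0 →
      z * (z - 2) * (z + 1) = 0 := by
    intro z hz
    rw [hs, ← he, he2, h3] at hz
    linear_combination hz
  have h1 := key (hroot u (by ring)) hp
  have h2 := key (hroot v (by ring)) hq
  have h4 := key (hroot w (by ring)) hr
  omega

/-! ### Valencies, traces and commutativity -/

namespace IsCoherentConfiguration

variable {Ω ι : Type*} [Fintype Ω] [DecidableEq Ω] [Fintype ι] {A : ι → Matrix Ω Ω ℂ}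

lemma star_apply (hA : IsCoherentConfiguration A) (i : ι) (x y : Ω) :
    star (A i x y) = A i x y := by
  rcases hA.zero_one i x y with h | h <;> simp [h]

lemma mul_self_apply (hA : IsCoherentConfiguration A) (i : ι) (x y : Ω) :
    A i x y * A i x y = A i x y := by
  rcases hA.zero_one i x y with h | h <;> simp [h]

lemma sum_apply (hA : IsCoherentConfiguration A) (x y : Ω) : ∑ i, A i x y = 1 := by
  have := congrFun (congrFun hA.sum_eq x) y
  simpa [Matrix.sum_apply] using this

lemma mul_apply_eq_zero (hA : IsCoherentConfiguration A) {i j : ι} (hij : i ≠ j) (x y : Ω) :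
    A i x y * A j x y = 0 := by
  classical
  rcases hA.zero_one i x y with hi | hi
  · simp [hi]
  rcases hA.zero_one j x y with hj | hj
  · simp [hj]
  exfalso
  have hnn : ∀ l ∈ Finset.univ, l ∉ ({i, j} : Finset ι) → 0 ≤ (A l x y).re := by
    intro l _ _
    rcases hA.zero_one l x y with h | h <;> simp [h]
  have h1 := Finset.sum_le_sum_of_subset_of_nonneg (Finset.subset_univ ({i, j} : Finset ι)) hnn
  have h2 := congrArg Complex.re (hA.sum_apply x y)
  rw [Complex.re_sum] at h2
  rw [h2, Finset.sum_pair hij, hi, hj] at h1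
  norm_num at h1

lemma exists_apply_eq_one (hA : IsCoherentConfiguration A) (i : ι) : ∃ x y, A i x y = 1 := by
  by_contra! h
  refine hA.ne_zero i ?_
  ext x y
  exact (hA.zero_one i x y).resolve_right (h x y)

lemma apply_eq_zero_of_apply_eq_one (hA : IsCoherentConfiguration A) {i j : ι} (hij : i ≠ j)
    {x y : Ω} (h : A i x y = 1) : A j x y = 0 := by
  simpa [h] using hA.mul_apply_eq_zero hij x y

lemma linearIndependent (hA : IsCoherentConfiguration A) : LinearIndependent ℂ A := by
  classical
  rw [Fintype.linearIndependent_iff]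
  intro g hg i
  obtain ⟨x, y, hxy⟩ := hA.exists_apply_eq_one i
  have h := congrFun (congrFun hg x) y
  simp only [Matrix.sum_apply, Matrix.smul_apply, smul_eq_mul, Matrix.zero_apply] at h
  rw [Finset.sum_eq_single i] at h
  · simpa [hxy] using h
  · intro j _ hj
    rw [hA.apply_eq_zero_of_apply_eq_one hj.symm hxy, mul_zero]
  · simp

lemma injective (hA : IsCoherentConfiguration A) : Function.Injective A :=
  hA.linearIndependent.injective

lemma apply_self (hA : IsCoherentConfiguration A) {o : ι} (ho : A o = 1) {i : ι} (hi : i ≠ o)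
    (x : Ω) : A i x x = 0 :=
  hA.apply_eq_zero_of_apply_eq_one hi.symm (by simp [ho])

/-- The relations of a homogeneous configuration are regular: the common row sum is the diagonal
entry of `A i * (A i)ᵀ`. -/
lemma exists_row_sum (hA : IsCoherentConfiguration A) {o : ι} (ho : A o = 1) (i : ι) :
    ∃ k : ℕ, ∀ x, ∑ y, A i x y = k := by
  classical
  obtain ⟨j, hj⟩ := hA.transpose i
  obtain ⟨p, hp⟩ := hA.mul i j
  refine ⟨p o, fun x => ?_⟩
  have h := congrFun (congrFun hp x) x
  rw [← hj, Matrix.mul_apply] at h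
  simp only [Matrix.transpose_apply, hA.mul_self_apply, Matrix.sum_apply, Matrix.smul_apply,
    smul_eq_mul] at h
  rw [h, Finset.sum_eq_single o]
  · simp [ho]
  · intro l _ hl
    rw [hA.apply_self ho hl, mul_zero]
  · simp

/-- The valency of the relation `i`: the number of entries `1` in each row of `A i`
(junk if the row sums are not constant). -/
noncomputable def valency (A : ι → Matrix Ω Ω ℂ) (i : ι) : ℕ :=
  open Classical in
  if h : ∃ k : ℕ, ∀ x, ∑ y, A i x y = k then h.choose else 0

variable {o : ι}

lemma row_sum (hA : IsCoherentConfiguration A) (ho : A o = 1) (i : ι) (x : Ω) :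
    ∑ y, A i x y = valency A i := by
  rw [valency, dif_pos (hA.exists_row_sum ho i)]
  exact (hA.exists_row_sum ho i).choose_spec x

lemma card_mul_valency (hA : IsCoherentConfiguration A) (ho : A o = 1) (i : ι) :
    ∑ x, ∑ y, A i x y = Fintype.card Ω * valency A i := by
  simp [hA.row_sum ho]

lemma nonempty (hA : IsCoherentConfiguration A) (i : ι) : Nonempty Ω :=
  ⟨(hA.exists_apply_eq_one i).choose⟩

lemma card_ne_zero (hA : IsCoherentConfiguration A) (i : ι) : (Fintype.card Ω : ℂ) ≠ 0 := by
  have := hA.nonempty i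
  exact_mod_cast Fintype.card_ne_zero

lemma valency_eq_of_transpose (hA : IsCoherentConfiguration A) (ho : A o = 1) {i j : ι}
    (h : (A i).transpose = A j) : valency A j = valency A i := by
  have h1 := hA.card_mul_valency ho j
  simp only [← h, Matrix.transpose_apply] at h1
  rw [Finset.sum_comm, hA.card_mul_valency ho i] at h1
  exact_mod_cast (mul_left_cancel₀ (hA.card_ne_zero i) h1).symm

lemma col_sum (hA : IsCoherentConfiguration A) (ho : A o = 1) (i : ι) (y : Ω) :
    ∑ x, A i x y = valency A i := by
  obtain ⟨j, hj⟩ := hA.transpose i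
  rw [← hA.valency_eq_of_transpose ho hj, ← hA.row_sum ho j y, ← hj]
  rfl

lemma valency_pos (hA : IsCoherentConfiguration A) (ho : A o = 1) (i : ι) : 0 < valency A i := by
  obtain ⟨x, y, hxy⟩ := hA.exists_apply_eq_one i
  rw [Nat.pos_iff_ne_zero]
  intro h0
  have h := congrArg Complex.re (hA.row_sum ho i x)
  rw [Complex.re_sum, h0] at h
  have h1 := Finset.single_le_sum (f := fun y => (A i x y).re)
    (fun z _ => by rcases hA.zero_one i x z with h | h <;> simp [h]) (Finset.mem_univ y)
  simp only [h, hxy] at h1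
  norm_num at h1

lemma valency_ne_zero (hA : IsCoherentConfiguration A) (ho : A o = 1) (i : ι) :
    (valency A i : ℂ) ≠ 0 := by
  exact_mod_cast (hA.valency_pos ho i).ne'

lemma valency_diagonal (hA : IsCoherentConfiguration A) (ho : A o = 1) : valency A o = 1 := by
  have := hA.nonempty o
  have h := hA.row_sum ho o (Classical.arbitrary Ω)
  simp only [ho, Matrix.one_apply, Finset.sum_ite_eq, Finset.mem_univ, if_true] at h
  exact_mod_cast h.symm

lemma sum_valency (hA : IsCoherentConfiguration A) (ho : A o = 1) :
    ∑ i, valency A i = Fintype.card Ω := by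
  have := hA.nonempty o
  have h : ∑ i, (valency A i : ℂ) = Fintype.card Ω := by
    simp_rw [← hA.row_sum ho _ (Classical.arbitrary Ω)]
    rw [Finset.sum_comm]
    simp [hA.sum_apply]
  exact_mod_cast h

lemma mul_allOne (hA : IsCoherentConfiguration A) (ho : A o = 1) (i : ι) :
    A i * Matrix.of (fun _ _ => 1) = (valency A i : ℂ) • Matrix.of (fun _ _ : Ω => (1 : ℂ)) := by
  ext x y
  simp [Matrix.mul_apply, hA.row_sum ho]

lemma trace_mul_transpose_self (hA : IsCoherentConfiguration A) (ho : A o = 1) (i : ι) :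
    (A i * (A i).transpose).trace = Fintype.card Ω * valency A i := by
  simp only [Matrix.trace, Matrix.diag_apply, Matrix.mul_apply, Matrix.transpose_apply,
    hA.mul_self_apply]
  exact hA.card_mul_valency ho i

lemma trace_mul_transpose_of_ne (hA : IsCoherentConfiguration A) {i j : ι} (hij : i ≠ j) :
    (A i * (A j).transpose).trace = 0 := by
  simp [Matrix.trace, Matrix.mul_apply, hA.mul_apply_eq_zero hij]

/-- The trace form reads off coordinates with respect to the basis `A`. -/
lemma trace_sum_smul_mul_transpose (hA : IsCoherentConfiguration A) (ho : A o = 1)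
    (c : ι → ℂ) (l : ι) :
    ((∑ i, c i • A i) * (A l).transpose).trace = c l * (Fintype.card Ω * valency A l) := by
  classical
  rw [Finset.sum_mul, Matrix.trace_sum, Finset.sum_eq_single l]
  · rw [Matrix.smul_mul, Matrix.trace_smul, hA.trace_mul_transpose_self ho, smul_eq_mul]
  · intro i _ hi
    rw [Matrix.smul_mul, Matrix.trace_smul, hA.trace_mul_transpose_of_ne hi, smul_zero]
  · simp

lemma trace_eq_zero (hA : IsCoherentConfiguration A) (ho : A o = 1) {i : ι} (hi : i ≠ o) :
    (A i).trace = 0 := by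
  simp [Matrix.trace, hA.apply_self ho hi]

/-- Two relations commute if the trilinear form `trace (A i * A j * A l)` is symmetric in its
first two arguments. -/
lemma commute_of_trace_eq (hA : IsCoherentConfiguration A) (ho : A o = 1) {i j : ι}
    (h : ∀ l, (A i * A j * A l).trace = (A j * A i * A l).trace) : A i * A j = A j * A i := by
  obtain ⟨p, hp⟩ := hA.mul i j
  obtain ⟨q, hq⟩ := hA.mul j i
  rw [hp, hq]
  refine Finset.sum_congr rfl fun l _ => ?_
  obtain ⟨l', hl'⟩ := hA.transpose l
  have h1 := h l'
  rw [← hl', hp, hq, hA.trace_sum_smul_mul_transpose ho,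
    hA.trace_sum_smul_mul_transpose ho] at h1
  rw [mul_right_cancel₀ (mul_ne_zero (hA.card_ne_zero o) (hA.valency_ne_zero ho l)) h1]

end IsCoherentConfiguration

namespace IsCoherentConfiguration

variable {Ω : Type*} [Fintype Ω] [DecidableEq Ω] {A : Fin 4 → Matrix Ω Ω ℂ}

/-- A homogeneous configuration of rank `4` is commutative. If `i, j, l` are the three non-diagonal
relations, then `A l` is the all-one matrix minus `1 + A i + A j`, which makes the trilinear trace
form symmetric; in all other cases its cyclic invariance is enough. -/
lemma mul_comm_of_rank_four (hA : IsCoherentConfiguration A) (ho : A 0 = 1) (i j : Fin 4) :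
    A i * A j = A j * A i := by
  have cyc1 : ∀ M N : Matrix Ω Ω ℂ, (M * N * M).trace = (N * M * M).trace := fun M N => by
    rw [Matrix.trace_mul_comm, ← Matrix.mul_assoc, Matrix.trace_mul_comm, Matrix.mul_assoc]
  have cyc2 : ∀ M N : Matrix Ω Ω ℂ, (M * N * N).trace = (N * M * N).trace := fun M N =>
    (cyc1 N M).symm
  rcases eq_or_ne i 0 with rfl | hi
  · simp [ho]
  rcases eq_or_ne j 0 with rfl | hj
  · simp [ho]
  rcases eq_or_ne i j with rfl | hij
  · rfl
  refine hA.commute_of_trace_eq ho fun l => ?_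
  rcases eq_or_ne l 0 with rfl | hl
  · simp [ho, Matrix.trace_mul_comm (A i)]
  rcases eq_or_ne l i with rfl | hli
  · exact cyc1 _ _
  rcases eq_or_ne l j with rfl | hlj
  · exact cyc2 _ _
  have hl : A l = Matrix.of (fun _ _ => 1) - 1 - A i - A j := by
    have huniv : (Finset.univ : Finset (Fin 4)) = {0, i, j, l} := by
      revert i j l; decide
    have h := hA.sum_eq
    rw [huniv, Finset.sum_insert (by simp [hi.symm, hj.symm, hl.symm]),
      Finset.sum_insert (by simp [hij, hli.symm]), Finset.sum_pair hlj.symm, ho] at h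
    rw [← h]; abel
  have hJ : (A i * A j * Matrix.of (fun _ _ => 1)).trace =
      (A j * A i * Matrix.of (fun _ _ => 1)).trace := by
    rw [Matrix.mul_assoc, hA.mul_allOne ho, Matrix.mul_assoc, hA.mul_allOne ho, Matrix.mul_smul,
      hA.mul_allOne ho, Matrix.mul_smul, hA.mul_allOne ho, smul_smul, smul_smul, mul_comm]
  simp only [hl, mul_sub, Matrix.trace_sub, mul_one, hJ, cyc1, cyc2,
    Matrix.trace_mul_comm (A i) (A j)]

end IsCoherentConfiguration

/-! ### Eigenvectors and connectedness -/

namespace IsCoherentConfiguration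

variable {Ω ι : Type*} [Fintype Ω] [DecidableEq Ω] [Fintype ι] {A : ι → Matrix Ω Ω ℂ} {o : ι}

/-- The energy of an eigenvector of `A i` for a real eigenvalue `t`. -/
lemma sum_mul_normSq_sub (hA : IsCoherentConfiguration A) (ho : A o = 1) {i : ι} {t : ℝ}
    {w : Ω → ℂ} (hw : (A i).mulVec w = (t : ℂ) • w) :
    ∑ x, ∑ y, (A i x y).re * Complex.normSq (w x - w y) =
      2 * (valency A i - t) * ∑ x, Complex.normSq (w x) := by
  have hre : ∀ x y, A i x y = ((A i x y).re : ℂ) := fun x y => by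
    rcases hA.zero_one i x y with h | h <;> simp [h]
  have hw' : ∀ x, ∑ y, A i x y * w y = t * w x := fun x => congrFun hw x
  have h1 : ∑ x, ∑ y, A i x y * (star (w x) * w x) = valency A i * ∑ x, star (w x) * w x := by
    simp_rw [← Finset.sum_mul, hA.row_sum ho, Finset.mul_sum]
  have h2 : ∑ x, ∑ y, A i x y * (star (w y) * w y) = valency A i * ∑ x, star (w x) * w x := by
    rw [Finset.sum_comm]
    simp_rw [← Finset.sum_mul, hA.col_sum ho, Finset.mul_sum]
  have h3 : ∑ x, ∑ y, A i x y * (star (w x) * w y) = t * ∑ x, star (w x) * w x := by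
    rw [Finset.mul_sum]
    refine Finset.sum_congr rfl fun x _ => ?_
    rw [← mul_assoc, mul_right_comm, ← hw' x, Finset.sum_mul]
    exact Finset.sum_congr rfl fun y _ => by ring
  have h4 : ∑ x, ∑ y, A i x y * (star (w y) * w x) = t * ∑ x, star (w x) * w x := by
    have h := congrArg star h3
    simp only [star_sum, star_mul', hA.star_apply, Complex.star_def, Complex.conj_conj,
      Complex.conj_ofReal] at h
    calc ∑ x, ∑ y, A i x y * (star (w y) * w x)
        = ∑ x, ∑ y, A i x y * (w x * star (w y)) := by simp_rw [mul_comm]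
      _ = t * ∑ x, star (w x) * w x := by
          simp_rw [mul_comm (star (w _)) (w _)]; exact h
  apply Complex.ofReal_injective
  push_cast
  simp_rw [← hre, Complex.normSq_eq_conj_mul_self, ← Complex.star_def, star_sub]
  calc ∑ x, ∑ y, A i x y * ((star (w x) - star (w y)) * (w x - w y))
      = ∑ x, ∑ y, A i x y * (star (w x) * w x) + ∑ x, ∑ y, A i x y * (star (w y) * w y)
        - ∑ x, ∑ y, A i x y * (star (w x) * w y) - ∑ x, ∑ y, A i x y * (star (w y) * w x) := by
        simp_rw [← Finset.sum_add_distrib, ← Finset.sum_sub_distrib]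
        exact Finset.sum_congr rfl fun x _ => Finset.sum_congr rfl fun y _ => by ring
    _ = _ := by rw [h1, h2, h3, h4]; ring

lemma re_mul_normSq_nonneg (hA : IsCoherentConfiguration A) (i : ι) (x y : Ω) (z : ℂ) :
    0 ≤ (A i x y).re * Complex.normSq z := by
  refine mul_nonneg ?_ (Complex.normSq_nonneg z)
  rcases hA.zero_one i x y with h | h <;> simp [h]

lemma le_valency_of_eigenvector (hA : IsCoherentConfiguration A) (ho : A o = 1) {i : ι} {t : ℝ}
    {w : Ω → ℂ} (hw : (A i).mulVec w = (t : ℂ) • w) (hw0 : w ≠ 0) : t ≤ valency A i := by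
  have h := hA.sum_mul_normSq_sub ho hw
  have h0 : 0 ≤ ∑ x, ∑ y, (A i x y).re * Complex.normSq (w x - w y) :=
    Finset.sum_nonneg fun x _ => Finset.sum_nonneg fun y _ => hA.re_mul_normSq_nonneg i x y _
  have hpos : 0 < ∑ x, Complex.normSq (w x) := by
    obtain ⟨x, hx⟩ := Function.ne_iff.mp hw0
    exact Finset.sum_pos' (fun x _ => Complex.normSq_nonneg _)
      ⟨x, Finset.mem_univ x, Complex.normSq_pos.mpr hx⟩
  rw [h] at h0
  have := nonneg_of_mul_nonneg_left h0 hpos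
  linarith

/-- If the relation `i` is connected, its valency is a simple eigenvalue: the energy of a fixed
vector vanishes. -/
lemma eq_of_connected (hA : IsCoherentConfiguration A) (ho : A o = 1) {i : ι}
    (hc : (relationGraph (A i)).Connected) {w : Ω → ℂ}
    (hw : (A i).mulVec w = (valency A i : ℂ) • w) (x y : Ω) : w x = w y := by
  have h := hA.sum_mul_normSq_sub ho (t := valency A i) (by exact_mod_cast hw)
  rw [sub_self, mul_zero, zero_mul, Finset.sum_eq_zero_iff_of_nonneg
    (fun x _ => Finset.sum_nonneg fun y _ => hA.re_mul_normSq_nonneg i x y _)] at h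
  have hedge : ∀ x y, A i x y = 1 → w x = w y := by
    intro x y hxy
    have h1 := h x (Finset.mem_univ x)
    rw [Finset.sum_eq_zero_iff_of_nonneg (fun y _ => hA.re_mul_normSq_nonneg i x y _)] at h1
    have h2 := h1 y (Finset.mem_univ y)
    rw [hxy, Complex.one_re, one_mul, Complex.normSq_eq_zero, sub_eq_zero] at h2
    exact h2
  have hadj : ∀ x y, (relationGraph (A i)).Adj x y → w x = w y := by
    intro x y hxy
    rcases (SimpleGraph.fromRel_adj _ _ _).mp hxy with ⟨_, h | h⟩
    · exact hedge x y h
    · exact (hedge y x h).symm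
  obtain ⟨p⟩ := hc.preconnected x y
  induction p with
  | nil => rfl
  | cons hh _ ih => exact (hadj _ _ hh).trans ih

/-- The matrix version of `eq_of_connected`, applied to the columns of `M`. -/
lemma apply_eq_of_mul_eq (hA : IsCoherentConfiguration A) (ho : A o = 1) {i : ι}
    (hc : (relationGraph (A i)).Connected) {M : Matrix Ω Ω ℂ}
    (hM : A i * M = (valency A i : ℂ) • M) (x y z : Ω) : M x z = M y z := by
  refine hA.eq_of_connected ho hc (w := fun x => M x z) ?_ x y
  ext x
  exact congrFun (congrFun hM x) z

/-- If `A i` has valency `1`, multiplication by it permutes the relations of valency `1`. -/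
lemma exists_mul_eq_of_valency_eq_one (hA : IsCoherentConfiguration A) (ho : A o = 1) {i j : ι}
    (hi : valency A i = 1) (hj : valency A j = 1) :
    ∃ l, valency A l = 1 ∧ A i * A j = A l := by
  classical
  obtain ⟨p, hp⟩ := hA.mul i j
  have hsum : ∑ l, p l * valency A l = 1 := by
    have := hA.nonempty o
    have x := Classical.arbitrary Ω
    have h : (A i * A j) * Matrix.of (fun _ _ => 1) = Matrix.of (fun _ _ : Ω => (1 : ℂ)) := by
      rw [Matrix.mul_assoc, hA.mul_allOne ho, hj, Nat.cast_one, one_smul, hA.mul_allOne ho, hi,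
        Nat.cast_one, one_smul]
    rw [hp, Finset.sum_mul] at h
    simp_rw [Matrix.smul_mul, hA.mul_allOne ho, smul_smul, ← Finset.sum_smul] at h
    have h1 := congrFun (congrFun h x) x
    simp only [Matrix.smul_apply, Matrix.of_apply, smul_eq_mul, mul_one] at h1
    exact_mod_cast h1
  obtain ⟨l, hl⟩ : ∃ l, p l ≠ 0 := by
    by_contra! h
    simp [h] at hsum
  have hrest := Finset.add_sum_erase Finset.univ (fun l => p l * valency A l) (Finset.mem_univ l)
  have hpos := Nat.mul_pos (Nat.pos_of_ne_zero hl) (hA.valency_pos ho l)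
  simp only [hsum] at hrest
  have h1 : p l * valency A l = 1 := by omega
  have h0 : ∑ m ∈ Finset.univ.erase l, p m * valency A m = 0 := by omega
  refine ⟨l, Nat.eq_one_of_mul_eq_one_left h1, ?_⟩
  rw [hp, Finset.sum_eq_single l, Nat.eq_one_of_mul_eq_one_right h1, Nat.cast_one, one_smul]
  · intro m _ hm
    have h2 := Finset.sum_eq_zero_iff.mp h0 m (Finset.mem_erase.mpr ⟨hm, Finset.mem_univ m⟩)
    have h3 := (Nat.mul_eq_zero.mp h2).resolve_right (hA.valency_pos ho m).ne'
    simp [h3]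
  · simp

/-- If a connected relation has valency `1`, then all relations have valency `1`: the sum of the
relations of valency `1` is fixed by each of them, so it is the all-one matrix. -/
lemma card_le_of_valency_eq_one (hA : IsCoherentConfiguration A) (ho : A o = 1) {i : ι}
    (hc : (relationGraph (A i)).Connected) (hi : valency A i = 1) :
    Fintype.card Ω ≤ Fintype.card ι := by
  classical
  obtain ⟨i', hi'⟩ := hA.transpose i
  have hv' : valency A i' = 1 := (hA.valency_eq_of_transpose ho hi').trans hi
  set S : Finset ι := Finset.univ.filter fun l => valency A l = 1 with hS
  have hoS : o ∈ S := by simp [hS, hA.valency_diagonal ho]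
  -- the inverse of the permutation matrix `A i` is its transpose
  have hinv : A i' * A i = 1 := by
    obtain ⟨l, hl, hmul⟩ := hA.exists_mul_eq_of_valency_eq_one ho hv' hi
    rw [hmul, ← ho]
    congr 1
    by_contra hlo
    have h := hA.trace_eq_zero ho hlo
    rw [← hmul, ← hi', Matrix.trace_mul_comm, hA.trace_mul_transpose_self ho, hi] at h
    exact hA.card_ne_zero o (by simpa using h)
  choose f hf1 hf2 using fun (l : ι) (hl : l ∈ S) =>
    hA.exists_mul_eq_of_valency_eq_one ho hi (Finset.mem_filter.mp hl).2
  have hT : A i * ∑ l ∈ S, A l = ∑ l ∈ S, A l := by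
    rw [Finset.mul_sum]
    have hfinj : ∀ l m (hl : l ∈ S) (hm : m ∈ S), f l hl = f m hm → l = m := by
      intro l m hl hm h
      apply hA.injective
      have h1 : A i * A l = A i * A m := by rw [hf2 l hl, hf2 m hm, h]
      simpa [← Matrix.mul_assoc, hinv] using congrArg (A i' * ·) h1
    refine Finset.sum_bij f (fun l hl => by simp [hS, hf1 l hl])
      (fun l hl m hm => hfinj l m hl hm) ?_ hf2
    intro b hb
    obtain ⟨l, hl, h⟩ := Finset.surj_on_of_inj_on_of_card_le f
      (fun l hl => by simp [hS, hf1 l hl]) hfinj le_rfl b hb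
    exact ⟨l, hl, h.symm⟩
  have hconst := hA.apply_eq_of_mul_eq ho hc (M := ∑ l ∈ S, A l) (by rw [hT, hi]; simp)
  have hone : ∀ x y, ∑ l ∈ S, A l x y = 1 := by
    intro x y
    have h := hconst x y y
    simp only [Matrix.sum_apply] at h
    rw [h, Finset.sum_eq_single o]
    · simp [ho]
    · intro l _ hl
      exact hA.apply_self ho hl y
    · exact fun h => absurd hoS h
  have := hA.nonempty o
  have hcard : (Fintype.card Ω : ℂ) = S.card := by
    have x := Classical.arbitrary Ω
    calc (Fintype.card Ω : ℂ) = ∑ y : Ω, ∑ l ∈ S, A l x y := by simp [hone]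
      _ = ∑ l ∈ S, ∑ y, A l x y := Finset.sum_comm
      _ = ∑ l ∈ S, 1 := Finset.sum_congr rfl fun l hl => by
          rw [hA.row_sum ho, (Finset.mem_filter.mp hl).2, Nat.cast_one]
      _ = S.card := by simp
  have : Fintype.card Ω = S.card := by exact_mod_cast hcard
  rw [this]
  exact Finset.card_le_univ S

end IsCoherentConfiguration

/-! ### Primitive idempotents and characters -/

/-- A finite reduced commutative algebra over an algebraically closed field is a power of it. -/
lemma exists_algEquiv_pi (K R ι : Type*) [Field K] [IsAlgClosed K] [CommRing R] [Algebra K R]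
    [Module.Finite K R] [IsReduced R] [Fintype ι] (h : Module.finrank K R = Fintype.card ι) :
    Nonempty (R ≃ₐ[K] (ι → K)) := by
  have : IsArtinianRing R := IsArtinianRing.of_finite K R
  let e1 : ∀ I : MaximalSpectrum R, K ≃ₐ[K] R ⧸ I.asIdeal := fun I =>
    AlgEquiv.ofBijective (Algebra.ofId K _) <| by
      have := I.isMaximal
      let _ := Ideal.Quotient.field I.asIdeal
      exact IsAlgClosed.algebraMap_bijective_of_isIntegral
  let e2 : R ≃ₐ[K] (MaximalSpectrum R → K) :=
    ((IsArtinianRing.equivPi R).restrictScalars K).trans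
      (AlgEquiv.piCongrRight fun I => (e1 I).symm)
  have := Fintype.ofFinite (MaximalSpectrum R)
  have hc : Fintype.card (MaximalSpectrum R) = Fintype.card ι := by
    rw [← h, e2.toLinearEquiv.finrank_eq, Module.finrank_fintype_fun_eq_card]
  have σ := Fintype.equivOfCardEq hc
  exact ⟨e2.trans (AlgEquiv.piCongrLeft K (fun _ => K) σ)⟩

/-- The matrices `E a` are the primitive idempotents of the algebra spanned by the commuting
matrices `A i`, and `χ a i` is the value at `A i` of the character that belongs to `E a`.
The idempotents are indexed by the relations since there are equally many. -/
structure IsSpectralDecomposition {Ω ι : Type*} [Fintype Ω] [Fintype ι]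
    (A E : ι → Matrix Ω Ω ℂ) (χ : ι → ι → ℂ) : Prop where
  mul_self : ∀ a, E a * E a = E a
  mul_of_ne : ∀ a b, a ≠ b → E a * E b = 0
  ne_zero : ∀ a, E a ≠ 0
  eq_sum : ∀ i, A i = ∑ a, χ a i • E a
  mem_span : ∀ a, ∃ c : ι → ℂ, E a = ∑ i, c i • A i

open scoped ComplexOrder in
/-- The adjacency algebra is closed under conjugate transposition, hence reduced; being commutative
it is a product of copies of `ℂ`. -/
lemma IsCoherentConfiguration.exists_spectralDecomposition {Ω ι : Type*} [Fintype Ω]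
    [DecidableEq Ω] [Fintype ι] {A : ι → Matrix Ω Ω ℂ} {o : ι} (hA : IsCoherentConfiguration A)
    (ho : A o = 1) (hcomm : ∀ i j, A i * A j = A j * A i) :
    ∃ E χ, IsSpectralDecomposition A E χ := by
  classical
  let V : Submodule ℂ (Matrix Ω Ω ℂ) := Submodule.span ℂ (Set.range A)
  have hAV : ∀ i, A i ∈ V := fun i => Submodule.subset_span ⟨i, rfl⟩
  have hmul : ∀ x y, x ∈ V → y ∈ V → x * y ∈ V := by
    intro x y hx hy
    refine Submodule.span_induction₂ (p := fun x y _ _ => x * y ∈ V) ?_ ?_ ?_ ?_ ?_ ?_ ?_ hx hy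
    · rintro _ _ ⟨i, rfl⟩ ⟨j, rfl⟩
      obtain ⟨p, hp⟩ := hA.mul i j
      rw [hp]
      exact V.sum_mem fun l _ => V.smul_mem _ (hAV l)
    · simp
    · simp
    · intro x y z _ _ _ h1 h2
      rw [add_mul]; exact V.add_mem h1 h2
    · intro x y z _ _ _ h1 h2
      rw [mul_add]; exact V.add_mem h1 h2
    · intro r x y _ _ h
      rw [Matrix.smul_mul]; exact V.smul_mem _ h
    · intro r x y _ _ h
      rw [Matrix.mul_smul]; exact V.smul_mem _ h
  have hcommV : ∀ x y, x ∈ V → y ∈ V → x * y = y * x := by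
    intro x y hx hy
    refine Submodule.span_induction₂ (p := fun x y _ _ => x * y = y * x) ?_ ?_ ?_ ?_ ?_ ?_ ?_ hx hy
    · rintro _ _ ⟨i, rfl⟩ ⟨j, rfl⟩
      exact hcomm i j
    · simp
    · simp
    · intro x y z _ _ _ h1 h2
      rw [add_mul, mul_add, h1, h2]
    · intro x y z _ _ _ h1 h2
      rw [mul_add, add_mul, h1, h2]
    · intro r x y _ _ h
      rw [Matrix.smul_mul, Matrix.mul_smul, h]
    · intro r x y _ _ h
      rw [Matrix.smul_mul, Matrix.mul_smul, h]
  have hstar : ∀ x, x ∈ V → x.conjTranspose ∈ V := by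
    intro x hx
    refine Submodule.span_induction (p := fun x _ => x.conjTranspose ∈ V) ?_ ?_ ?_ ?_ hx
    · rintro _ ⟨i, rfl⟩
      obtain ⟨j, hj⟩ := hA.transpose i
      have : (A i).conjTranspose = A j := by
        rw [← hj]
        ext x y
        exact hA.star_apply i y x
      rw [this]; exact hAV j
    · simp
    · intro x y _ _ h1 h2
      rw [Matrix.conjTranspose_add]; exact V.add_mem h1 h2
    · intro r x _ h
      rw [Matrix.conjTranspose_smul]; exact V.smul_mem _ h
  let S : Subalgebra ℂ (Matrix Ω Ω ℂ) := V.toSubalgebra (ho ▸ hAV o) hmul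
  let _ : CommRing S :=
    { (inferInstance : Ring S) with
      mul_comm := fun x y => Subtype.ext (hcommV x y x.2 y.2) }
  have hred : IsReduced S := by
    rw [isReduced_iff_pow_one_lt 2 one_lt_two]
    intro x hx
    have hx0 : (x : Matrix Ω Ω ℂ) * x = 0 := by
      have := congrArg Subtype.val hx
      rwa [pow_two] at this
    obtain ⟨X, hX⟩ := x
    change X * X = 0 at hx0
    have hc : X.conjTranspose * X = X * X.conjTranspose := hcommV _ _ (hstar _ hX) hX
    have h1 : (X.conjTranspose * X).conjTranspose * (X.conjTranspose * X) = 0 := by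
      rw [Matrix.conjTranspose_mul, Matrix.conjTranspose_conjTranspose]
      calc X.conjTranspose * X * (X.conjTranspose * X)
          = X.conjTranspose * (X.conjTranspose * (X * X)) := by
            rw [Matrix.mul_assoc, ← Matrix.mul_assoc X, ← hc, Matrix.mul_assoc]
        _ = 0 := by rw [hx0]; simp
    exact Subtype.ext (Matrix.conjTranspose_mul_self_eq_zero.mp
      (Matrix.conjTranspose_mul_self_eq_zero.mp h1))
  have hrank : Module.finrank ℂ S = Fintype.card ι := finrank_span_eq_card hA.linearIndependent
  have hfin : Module.Finite ℂ S := FiniteDimensional.span_of_finite ℂ (Set.finite_range A)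
  obtain ⟨φ⟩ := exists_algEquiv_pi ℂ S ι hrank
  let e : ι → S := fun a => φ.symm (Pi.single a 1)
  refine ⟨fun a => (e a : Matrix Ω Ω ℂ), fun a i => φ ⟨A i, hAV i⟩ a, ?_, ?_, ?_, ?_, ?_⟩
  · intro a
    have : e a * e a = e a := by
      simp only [e, ← map_mul, ← Pi.single_mul, mul_one]
    exact congrArg Subtype.val this
  · intro a b hab
    have : e a * e b = 0 := by
      simp only [e, ← map_mul]
      have h0 : (Pi.single a 1 * Pi.single b 1 : ι → ℂ) = 0 := by
        ext d
        by_cases h : d = a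
        · subst h; simp [hab]
        · simp [Pi.single_apply, h]
      rw [h0, map_zero]
    exact congrArg Subtype.val this
  · intro a h
    have h0 : e a = 0 := Subtype.ext h
    have h1 : (Pi.single a 1 : ι → ℂ) = 0 := by simpa [e] using congrArg φ h0
    simpa using congrFun h1 a
  · intro i
    have h : (⟨A i, hAV i⟩ : S) = ∑ a, φ ⟨A i, hAV i⟩ a • e a := by
      apply φ.injective
      rw [map_sum]
      simp only [map_smul, e, AlgEquiv.apply_symm_apply]
      ext b
      simp [Finset.sum_apply, Pi.single_apply]
    have h2 := congrArg S.val h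
    simpa using h2
  · intro a
    obtain ⟨c, hc⟩ := (Submodule.mem_span_range_iff_exists_fun ℂ).mp (e a).2
    exact ⟨c, hc.symm⟩

namespace IsSpectralDecomposition

variable {Ω ι : Type*} [Fintype Ω] [Fintype ι] {A E : ι → Matrix Ω Ω ℂ} {χ : ι → ι → ℂ} {o : ι}

lemma mul_eq_ite [DecidableEq ι] (h : IsSpectralDecomposition A E χ) (a b : ι) :
    E a * E b = if a = b then E a else 0 := by
  split_ifs with hab
  · rw [hab, h.mul_self]
  · exact h.mul_of_ne a b hab

lemma sum_smul_mul (h : IsSpectralDecomposition A E χ) (c : ι → ℂ) (a : ι) :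
    (∑ b, c b • E b) * E a = c a • E a := by
  classical
  simp [Finset.sum_mul, h.mul_eq_ite]

lemma mul_eq_smul (h : IsSpectralDecomposition A E χ) (i a : ι) :
    A i * E a = χ a i • E a := by
  rw [h.eq_sum i, h.sum_smul_mul]

lemma mul_eq_smul' (h : IsSpectralDecomposition A E χ) (i a : ι) :
    E a * A i = χ a i • E a := by
  classical
  rw [h.eq_sum i, Finset.mul_sum]
  simp [h.mul_eq_ite]

lemma eq_of_smul_eq (h : IsSpectralDecomposition A E χ) {a : ι} {x y : ℂ}
    (hxy : x • E a = y • E a) : x = y :=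
  smul_left_injective ℂ (h.ne_zero a) hxy

/-- Different characters differ at one of the relations. -/
lemma exists_ne (h : IsSpectralDecomposition A E χ) {a b : ι} (hab : a ≠ b) :
    ∃ i, χ a i ≠ χ b i := by
  by_contra! hc
  obtain ⟨c, hE⟩ := h.mem_span a
  have key : ∀ d, E a * E d = (∑ i, c i * χ d i) • E d := by
    intro d
    rw [hE, Finset.sum_mul, Finset.sum_smul]
    exact Finset.sum_congr rfl fun i _ => by rw [Matrix.smul_mul, h.mul_eq_smul, smul_smul]
  have ha : (1 : ℂ) = ∑ i, c i * χ a i := by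
    apply h.eq_of_smul_eq (a := a)
    rw [← key, h.mul_self, one_smul]
  have hb : (0 : ℂ) = ∑ i, c i * χ b i := by
    apply h.eq_of_smul_eq (a := b)
    rw [← key, h.mul_of_ne a b hab, zero_smul]
  simp_rw [hc] at ha
  exact one_ne_zero (ha.trans hb.symm)

/-- A spectral decomposition can be renumbered. -/
lemma reindex (h : IsSpectralDecomposition A E χ) (ρ : Equiv.Perm ι) :
    IsSpectralDecomposition A (fun a => E (ρ a)) (fun a => χ (ρ a)) where
  mul_self a := h.mul_self _
  mul_of_ne a b hab := h.mul_of_ne _ _ (ρ.injective.ne hab)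
  ne_zero a := h.ne_zero _
  eq_sum i := by rw [h.eq_sum i, ← Equiv.sum_comp ρ]
  mem_span a := h.mem_span _

variable [DecidableEq Ω]

/-- The rank of a primitive idempotent, which is the multiplicity of its character. -/
noncomputable def idempotentRank (E : ι → Matrix Ω Ω ℂ) (a : ι) : ℕ :=
  Module.finrank ℂ (LinearMap.range (Matrix.toLin' (E a)))

lemma character_diagonal (h : IsSpectralDecomposition A E χ) (ho : A o = 1) (a : ι) :
    χ a o = 1 := by
  apply h.eq_of_smul_eq (a := a)
  rw [← h.mul_eq_smul, ho, one_mul, one_smul]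

lemma sum_eq_one (h : IsSpectralDecomposition A E χ) (ho : A o = 1) : ∑ a, E a = 1 := by
  rw [← ho, h.eq_sum o]
  simp [h.character_diagonal ho]

lemma trace_eq_finrank {M : Matrix Ω Ω ℂ} (hM : M * M = M) :
    M.trace = Module.finrank ℂ (LinearMap.range (Matrix.toLin' M)) := by
  have hid : IsIdempotentElem (Matrix.toLin' M) := by
    rw [IsIdempotentElem, Module.End.mul_eq_comp, ← Matrix.toLin'_mul, hM]
  rw [← Matrix.trace_toLin'_eq, (LinearMap.IsIdempotentElem.isProj_range _ hid).trace]

lemma trace_eq_idempotentRank (h : IsSpectralDecomposition A E χ) (a : ι) :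
    (E a).trace = idempotentRank E a :=
  trace_eq_finrank (h.mul_self a)

lemma idempotentRank_pos (h : IsSpectralDecomposition A E χ) (a : ι) : 0 < idempotentRank E a := by
  rw [Nat.pos_iff_ne_zero, idempotentRank, Ne, Submodule.finrank_eq_zero, LinearMap.range_eq_bot]
  intro h0
  exact h.ne_zero a (by simpa using h0)

/-- The algebraic multiplicity of an eigenvalue of `A i` is the sum of the multiplicities of the
characters with this value at `A i`. -/
lemma rootMultiplicity_charpoly (h : IsSpectralDecomposition A E χ) (ho : A o = 1) (i : ι) (z : ℂ)
    [DecidablePred fun a => χ a i = z] :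
    (A i).charpoly.rootMultiplicity z =
      ∑ a ∈ Finset.univ.filter (fun a => χ a i = z), idempotentRank E a := by
  classical
  set S := Finset.univ.filter (fun a => χ a i = z) with hS
  have hF : (∑ a ∈ S, E a) * (∑ a ∈ S, E a) = ∑ a ∈ S, E a := by
    rw [Finset.sum_mul_sum]
    refine Finset.sum_congr rfl fun a ha => ?_
    simp [h.mul_eq_ite, ha]
  have hspace : Module.End.maxGenEigenspace (Matrix.toLin' (A i)) z =
      LinearMap.range (Matrix.toLin' (∑ a ∈ S, E a)) := by
    ext v
    rw [Module.End.mem_maxGenEigenspace, LinearMap.mem_range]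
    constructor
    · rintro ⟨k, hk⟩
      have hpow : ∀ (a : ι) (k : ℕ) (v : Ω → ℂ),
          (E a).mulVec (((Matrix.toLin' (A i) - z • (1 : Module.End ℂ (Ω → ℂ))) ^ k) v) =
            (χ a i - z) ^ k • (E a).mulVec v := by
        intro a k
        induction k with
        | zero => simp
        | succ k ih =>
          intro v
          rw [pow_succ, Module.End.mul_apply, ih, pow_succ, mul_smul]
          congr 1
          simp only [LinearMap.sub_apply, Matrix.toLin'_apply, LinearMap.smul_apply,
            Module.End.one_apply, Matrix.mulVec_sub, Matrix.mulVec_mulVec, h.mul_eq_smul',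
            Matrix.mulVec_smul, Matrix.smul_mulVec, sub_smul]
      have hzero : ∀ a ∉ S, (E a).mulVec v = 0 := by
        intro a ha
        have h1 := hpow a k v
        rw [hk, Matrix.mulVec_zero] at h1
        refine (smul_eq_zero.mp h1.symm).resolve_left (pow_ne_zero k ?_)
        rw [sub_ne_zero]
        simpa [hS] using ha
      refine ⟨v, ?_⟩
      have h1 : (∑ a, E a).mulVec v = v := by rw [h.sum_eq_one ho, Matrix.one_mulVec]
      rw [Matrix.toLin'_apply]
      nth_rewrite 2 [← h1]
      rw [Matrix.sum_mulVec, Matrix.sum_mulVec]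
      exact Finset.sum_subset (Finset.subset_univ S) fun a _ ha => hzero a ha
    · rintro ⟨w, rfl⟩
      refine ⟨1, ?_⟩
      have h1 : A i * ∑ a ∈ S, E a = z • ∑ a ∈ S, E a := by
        rw [Finset.mul_sum, Finset.smul_sum]
        refine Finset.sum_congr rfl fun a ha => ?_
        rw [h.mul_eq_smul, (Finset.mem_filter.mp ha).2]
      simp only [pow_one, LinearMap.sub_apply, Matrix.toLin'_apply, LinearMap.smul_apply,
        Module.End.one_apply, Matrix.mulVec_mulVec, h1, Matrix.smul_mulVec, sub_self]
  have h1 := LinearMap.finrank_maxGenEigenspace_eq (Matrix.toLin' (A i)) z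
  rw [hspace, Matrix.charpoly_toLin'] at h1
  rw [← h1]
  have h2 : ((∑ a ∈ S, E a).trace) = ∑ a ∈ S, (idempotentRank E a : ℂ) := by
    rw [Matrix.trace_sum]
    exact Finset.sum_congr rfl fun a _ => h.trace_eq_idempotentRank a
  rw [trace_eq_finrank hF] at h2
  exact_mod_cast h2

/-- One of the characters is the valency; it belongs to the idempotent with constant entries. -/
lemma exists_principal (h : IsSpectralDecomposition A E χ) (hA : IsCoherentConfiguration A)
    (ho : A o = 1) : ∃ a, (∀ i, χ a i = IsCoherentConfiguration.valency A i) ∧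
      idempotentRank E a = 1 ∧
      Matrix.of (fun _ _ : Ω => (1 : ℂ)) = (Fintype.card Ω : ℂ) • E a := by
  classical
  set J : Matrix Ω Ω ℂ := Matrix.of (fun _ _ => 1) with hJ
  have hsum : J = ∑ b, (∑ i, χ b i) • E b := by
    have hJA : J = ∑ i, A i := hA.sum_eq.symm
    rw [hJA]
    simp_rw [h.eq_sum, Finset.sum_smul]
    exact Finset.sum_comm
  have hprin : ∀ b, ∑ i, χ b i ≠ 0 → ∀ i, χ b i = IsCoherentConfiguration.valency A i := by
    intro b hb i
    have h1 : A i * (J * E b) = (IsCoherentConfiguration.valency A i : ℂ) • (J * E b) := by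
      rw [← Matrix.mul_assoc, hA.mul_allOne ho, Matrix.smul_mul]
    rw [hsum, h.sum_smul_mul, Matrix.mul_smul, h.mul_eq_smul, smul_smul, smul_smul] at h1
    have h2 := h.eq_of_smul_eq h1
    rw [mul_comm] at h2
    exact mul_right_cancel₀ hb h2
  obtain ⟨a, ha⟩ : ∃ a, ∑ i, χ a i ≠ 0 := by
    by_contra! hc
    have := hA.nonempty o
    have x := Classical.arbitrary Ω
    have h1 := congrFun (congrFun hsum x) x
    simp [hc, hJ] at h1
  have hJa : J = (Fintype.card Ω : ℂ) • E a := by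
    rw [hsum, Finset.sum_eq_single a]
    · simp_rw [hprin a ha]
      rw [← hA.sum_valency ho]
      push_cast
      rfl
    · intro b _ hb
      by_cases hb0 : ∑ i, χ b i = 0
      · rw [hb0, zero_smul]
      · obtain ⟨i, hi⟩ := h.exists_ne hb
        exact absurd ((hprin b hb0 i).trans (hprin a ha i).symm) hi
    · simp
  refine ⟨a, hprin a ha, ?_, hJa⟩
  have htr := congrArg Matrix.trace hJa
  rw [Matrix.trace_smul, h.trace_eq_idempotentRank, smul_eq_mul] at htr
  have h1 : J.trace = Fintype.card Ω := by simp [hJ, Matrix.trace]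
  rw [h1] at htr
  have h2 := mul_left_cancel₀ (hA.card_ne_zero o) ((mul_one _).trans htr)
  exact_mod_cast h2.symm

/-- For a connected relation the valency is taken by the principal character only. -/
lemma ne_valency (h : IsSpectralDecomposition A E χ) (hA : IsCoherentConfiguration A)
    (ho : A o = 1) {a b i : ι} (hc : (relationGraph (A i)).Connected)
    (hJ : Matrix.of (fun _ _ : Ω => (1 : ℂ)) = (Fintype.card Ω : ℂ) • E a) (hab : b ≠ a) :
    χ b i ≠ IsCoherentConfiguration.valency A i := by
  intro hχ
  have h1 := hA.apply_eq_of_mul_eq ho hc (M := E b) (by rw [h.mul_eq_smul, hχ])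
  have h2 : Matrix.of (fun _ _ : Ω => (1 : ℂ)) * E b = 0 := by
    rw [hJ, Matrix.smul_mul, h.mul_of_ne a b hab.symm, smul_zero]
  refine h.ne_zero b ?_
  ext x z
  have h3 := congrFun (congrFun h2 x) z
  simp only [Matrix.mul_apply, Matrix.of_apply, one_mul, Matrix.zero_apply] at h3
  rw [Finset.sum_congr rfl (fun y _ => h1 y x z), Finset.sum_const, nsmul_eq_mul] at h3
  exact (mul_eq_zero.mp h3).resolve_left (by simpa using hA.card_ne_zero o)

lemma sum_character_eq_zero (h : IsSpectralDecomposition A E χ) (hA : IsCoherentConfiguration A)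
    {a b : ι} (hJ : Matrix.of (fun _ _ : Ω => (1 : ℂ)) = (Fintype.card Ω : ℂ) • E a)
    (hab : b ≠ a) : ∑ i, χ b i = 0 := by
  apply h.eq_of_smul_eq (a := b)
  rw [zero_smul, Finset.sum_smul]
  simp_rw [← h.mul_eq_smul]
  rw [← Finset.sum_mul, hA.sum_eq, hJ, Matrix.smul_mul, h.mul_of_ne a b hab.symm, smul_zero]

lemma le_valency (h : IsSpectralDecomposition A E χ) (hA : IsCoherentConfiguration A)
    (ho : A o = 1) {a i : ι} {t : ℝ} (ht : χ a i = t) :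
    t ≤ IsCoherentConfiguration.valency A i := by
  obtain ⟨z, hz⟩ : ∃ z, (fun x => E a x z) ≠ 0 := by
    by_contra! hc
    refine h.ne_zero a ?_
    ext x z
    exact congrFun (hc z) x
  refine hA.le_valency_of_eigenvector ho (i := i) (w := fun x => E a x z) ?_ hz
  ext x
  rw [← ht]
  exact congrFun (congrFun (h.mul_eq_smul i a) x) z

lemma trace_pow (h : IsSpectralDecomposition A E χ) (i : ι) (k : ℕ) :
    (A i ^ (k + 1)).trace = ∑ a, χ a i ^ (k + 1) * idempotentRank E a := by
  have hp : A i ^ (k + 1) = ∑ a, χ a i ^ (k + 1) • E a := by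
    induction k with
    | zero => simpa using h.eq_sum i
    | succ k ih =>
      rw [pow_succ', ih, Finset.mul_sum]
      refine Finset.sum_congr rfl fun a _ => ?_
      rw [Matrix.mul_smul, h.mul_eq_smul, smul_smul, pow_succ _ (k + 1)]
  rw [hp, Matrix.trace_sum]
  simp [Matrix.trace_smul, h.trace_eq_idempotentRank]

end IsSpectralDecomposition

/-! ### Multiplicities of the characters -/

/-- Three distinct eigenvalues: the multiplicities `m` agree with `n, n, n - 1` up to order. -/
lemma multiplicities_of_distinct {n m₁ m₂ m₃ : ℕ} {α β γ r s t : ℂ} (hn : 2 ≤ n)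
    (h₁ : 0 < m₁) (h₂ : 0 < m₂) (h₃ : 0 < m₃) (hαβ : α ≠ β) (hαγ : α ≠ γ) (hβγ : β ≠ γ)
    (h : ∀ z, ((if α = z then m₁ else 0) + (if β = z then m₂ else 0) + if γ = z then m₃ else 0) =
      (if r = z then n else 0) + (if s = z then n else 0) + if t = z then n - 1 else 0) :
    (m₁ = n ∧ m₂ = n ∧ m₃ = n - 1) ∨ (m₁ = n ∧ m₂ = n - 1 ∧ m₃ = n) ∨
      (m₁ = n - 1 ∧ m₂ = n ∧ m₃ = n) := by
  have hmem : ∀ z, z = r ∨ z = s ∨ z = t → z = α ∨ z = β ∨ z = γ := by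
    intro z hz
    by_contra! hc
    have h1 := h z
    rw [if_neg (Ne.symm hc.1), if_neg (Ne.symm hc.2.1), if_neg (Ne.symm hc.2.2)] at h1
    rcases hz with rfl | rfl | rfl <;> simp only [if_true] at h1 <;> omega
  have hα := h α
  have hβ := h β
  have hγ := h γ
  rcases hmem r (by simp) with rfl | rfl | rfl <;> rcases hmem s (by simp) with rfl | rfl | rfl <;>
    rcases hmem t (by simp) with rfl | rfl | rfl <;>
    simp only [hαβ, hαγ, hβγ, hαβ.symm, hαγ.symm, hβγ.symm, if_true, if_false] at hα hβ hγ <;>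
    omega

/-- Two distinct eigenvalues, one of them taken by a single character. -/
lemma multiplicity_of_merged {n m₁ m₂ m₃ : ℕ} {α γ r s t : ℂ} (hn : 2 ≤ n)
    (h₁ : 0 < m₁) (h₃ : 0 < m₃) (hαγ : α ≠ γ)
    (h : ∀ z, ((if α = z then m₁ else 0) + (if α = z then m₂ else 0) + if γ = z then m₃ else 0) =
      (if r = z then n else 0) + (if s = z then n else 0) + if t = z then n - 1 else 0) :
    m₃ = n ∨ m₃ = n - 1 ∨ m₃ = 2 * n ∨ m₃ = 2 * n - 1 := by
  have hα := h α
  have hγ := h γ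
  simp only [hαγ, hαγ.symm, if_true, if_false] at hα hγ
  by_cases h1 : r = γ
  · have h1' : r ≠ α := fun h => hαγ (h.symm.trans h1)
    by_cases h2 : s = γ
    · have h2' : s ≠ α := fun h => hαγ (h.symm.trans h2)
      by_cases h3 : t = γ
      · have h3' : t ≠ α := fun h => hαγ (h.symm.trans h3)
        simp only [h1', h2', h3', if_false] at hα
        omega
      · simp only [h1, h2, h3, if_true, if_false] at hγ
        omega
    · by_cases h3 : t = γ <;> simp only [h1, h2, h3, if_true, if_false] at hγ <;> omega
  · by_cases h2 : s = γ <;> by_cases h3 : t = γ <;>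
      simp only [h1, h2, h3, if_true, if_false] at hγ <;> omega

lemma eq_of_sum_eq {f g : Fin 3 → ℂ} (h : ∑ i, f i = ∑ i, g i) {i j : Fin 3} (hij : i ≠ j)
    (hi : f i = g i) (hj : f j = g j) (l : Fin 3) : f l = g l := by
  rcases eq_or_ne l i with rfl | hli
  · exact hi
  rcases eq_or_ne l j with rfl | hlj
  · exact hj
  have huniv : ∀ i j l : Fin 3, i ≠ j → l ≠ i → l ≠ j →
      (Finset.univ : Finset (Fin 3)) = {i, j, l} := by decide
  rw [huniv i j l hij hli hlj, Finset.sum_insert (by simp [hij, hli.symm]),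
    Finset.sum_insert (by simp [hlj.symm]),
    Finset.sum_insert (by simp [hij, hli.symm]), Finset.sum_insert (by simp [hlj.symm]), hi, hj,
    Finset.sum_singleton, Finset.sum_singleton] at h
  exact add_left_cancel (add_left_cancel h)

lemma not_forall_or_of_unique {P Q : Fin 3 → Prop} (hP : ∀ i j, i ≠ j → P i → ¬ P j)
    (hQ : ∀ i j, i ≠ j → Q i → ¬ Q j) : ¬ ∀ i, P i ∨ Q i := by
  intro h
  rcases h 0 with h0 | h0 <;> rcases h 1 with h1 | h1 <;> rcases h 2 with h2 | h2
  · exact hP 0 1 (by decide) h0 h1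
  · exact hP 0 1 (by decide) h0 h1
  · exact hP 0 2 (by decide) h0 h2
  · exact hQ 1 2 (by decide) h1 h2
  · exact hP 1 2 (by decide) h1 h2
  · exact hQ 0 2 (by decide) h0 h2
  · exact hQ 0 1 (by decide) h0 h1
  · exact hQ 0 1 (by decide) h0 h1

/-- If each of three functions has a coincidence among its values at three points, then these
coincidences must be at different pairs of points, and each point is singled out once. -/
lemma multiplicities_of_characters {n : ℕ} (hn : 3 ≤ n) {m : Fin 3 → ℕ} {χ : Fin 3 → Fin 3 → ℂ}
    (hpos : ∀ a, 0 < m a) (hsum : ∑ a, m a = 3 * n - 1)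
    (hχ : ∀ a, ∑ i, χ a i = -1) (hne : ∀ a b, a ≠ b → ∃ i, χ a i ≠ χ b i)
    (h : ∀ i, ∃ r s t : ℂ, ∀ z, (∑ a, if χ a i = z then m a else 0) =
      (if r = z then n else 0) + (if s = z then n else 0) + if t = z then n - 1 else 0) :
    (m 0 = n ∧ m 1 = n ∧ m 2 = n - 1) ∨ (m 0 = n ∧ m 1 = n - 1 ∧ m 2 = n) ∨
      (m 0 = n - 1 ∧ m 1 = n ∧ m 2 = n) := by
  simp only [Fin.sum_univ_three] at h hsum
  by_contra hcon
  have hcoin : ∀ i, χ 0 i = χ 1 i ∨ χ 0 i = χ 2 i ∨ χ 1 i = χ 2 i := by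
    intro i
    by_contra! hc
    obtain ⟨r, s, t, hi⟩ := h i
    exact hcon (multiplicities_of_distinct (by omega) (hpos 0) (hpos 1) (hpos 2) hc.1 hc.2.1 hc.2.2 hi)
  -- a pair of points is merged by at most one of the functions
  have htwo : ∀ a b, a ≠ b → ∀ i j, i ≠ j → χ a i = χ b i → χ a j ≠ χ b j := by
    intro a b hab i j hij hi hj
    obtain ⟨l, hl⟩ := hne a b hab
    exact hl (eq_of_sum_eq ((hχ a).trans (hχ b).symm) hij hi hj l)
  have hm : ∀ i, (χ 0 i = χ 1 i → χ 0 i ≠ χ 2 i →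
        m 2 = n ∨ m 2 = n - 1 ∨ m 2 = 2 * n ∨ m 2 = 2 * n - 1) ∧
      (χ 0 i = χ 2 i → χ 0 i ≠ χ 1 i →
        m 1 = n ∨ m 1 = n - 1 ∨ m 1 = 2 * n ∨ m 1 = 2 * n - 1) ∧
      (χ 1 i = χ 2 i → χ 1 i ≠ χ 0 i →
        m 0 = n ∨ m 0 = n - 1 ∨ m 0 = 2 * n ∨ m 0 = 2 * n - 1) := by
    intro i
    obtain ⟨r, s, t, hi⟩ := h i
    refine ⟨fun h1 h2 => ?_, fun h1 h2 => ?_, fun h1 h2 => ?_⟩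
    · exact multiplicity_of_merged (m₁ := m 0) (m₂ := m 1) (by omega) (hpos 0) (hpos 2) h2 fun z => by
        rw [← hi z, ← h1]
    · exact multiplicity_of_merged (m₁ := m 0) (m₂ := m 2) (by omega) (hpos 0) (hpos 1) h2 fun z => by
        rw [← hi z, ← h1]; ring
    · exact multiplicity_of_merged (m₁ := m 1) (m₂ := m 2) (by omega) (hpos 1) (hpos 0) h2 fun z => by
        rw [← hi z, ← h1]; ring
  have hone : ∀ i, ¬ (χ 0 i = χ 1 i ∧ χ 0 i = χ 2 i) := by
    rintro i ⟨h1, h2⟩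
    obtain ⟨j, hj⟩ : ∃ j, i ≠ j := ⟨i + 1, by fin_cases i <;> decide⟩
    rcases hcoin j with h | h | h
    · exact htwo 0 1 (by decide) i j hj h1 h
    · exact htwo 0 2 (by decide) i j hj h2 h
    · exact htwo 1 2 (by decide) i j hj (h1.symm.trans h2) h
  have t01 := htwo 0 1 (by decide)
  have t02 := htwo 0 2 (by decide)
  have t12 := htwo 1 2 (by decide)
  have m2 : m 2 = n ∨ m 2 = n - 1 ∨ m 2 = 2 * n ∨ m 2 = 2 * n - 1 := by
    obtain ⟨i, hi⟩ : ∃ i, χ 0 i = χ 1 i := by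
      by_contra! hc
      exact not_forall_or_of_unique t02 t12 fun i => (hcoin i).resolve_left (hc i)
    exact (hm i).1 hi fun h => hone i ⟨hi, h⟩
  have m1 : m 1 = n ∨ m 1 = n - 1 ∨ m 1 = 2 * n ∨ m 1 = 2 * n - 1 := by
    obtain ⟨i, hi⟩ : ∃ i, χ 0 i = χ 2 i := by
      by_contra! hc
      exact not_forall_or_of_unique t01 t12 fun i => by have := hcoin i; have := hc i; tauto
    exact (hm i).2.1 hi fun h => hone i ⟨h, hi⟩
  have m0 : m 0 = n ∨ m 0 = n - 1 ∨ m 0 = 2 * n ∨ m 0 = 2 * n - 1 := by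
    obtain ⟨i, hi⟩ : ∃ i, χ 1 i = χ 2 i := by
      by_contra! hc
      exact not_forall_or_of_unique t01 t02 fun i => by have := hcoin i; have := hc i; tauto
    exact (hm i).2.2 hi fun h => hone i ⟨h.symm, h.symm.trans hi⟩
  have hsum' : m 0 + m 1 + m 2 = 3 * n - 1 := hsum
  clear hsum hm hpos h hcoin htwo hone t01 t02 t12 hne hχ
  generalize m 0 = a at *
  generalize m 1 = b at *
  generalize m 2 = c at *
  rcases m0 with rfl | rfl | rfl | rfl <;> rcases m1 with h1 | h1 | h1 | h1 <;>
    rcases m2 with h2 | h2 | h2 | h2 <;> omega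

/-! ### Rationality of eigenvalues -/

/-- Conjugate algebraic numbers have the same multiplicity as roots of a rational polynomial. -/
lemma rootMultiplicity_eq_of_isConjRoot {x y : ℂ} (hx : IsIntegral ℚ x) (hxy : IsConjRoot ℚ x y)
    (f : ℚ[X]) : (f.map (algebraMap ℚ ℂ)).rootMultiplicity x =
      (f.map (algebraMap ℚ ℂ)).rootMultiplicity y := by
  induction hd : f.natDegree using Nat.strong_induction_on generalizing f with
  | _ d ih =>
  rcases eq_or_ne f 0 with rfl | hf
  · simp
  by_cases hdvd : minpoly ℚ x ∣ f
  · obtain ⟨g, rfl⟩ := hdvd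
    have hmin := minpoly.ne_zero hx
    have hg : g ≠ 0 := right_ne_zero_of_mul hf
    have hlt : g.natDegree < d := by
      rw [← hd, natDegree_mul hmin hg]
      have := minpoly.natDegree_pos hx
      omega
    have hsimple : ∀ z : ℂ, minpoly ℚ z = minpoly ℚ x →
        ((minpoly ℚ x).map (algebraMap ℚ ℂ)).rootMultiplicity z = 1 := by
      intro z hz
      refine le_antisymm ?_ ?_
      · exact rootMultiplicity_le_one_of_separable
          (minpoly.irreducible hx).separable.map z
      · rw [Nat.succ_le_iff, rootMultiplicity_pos (map_ne_zero hmin), IsRoot.def, eval_map_algebraMap,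
          ← hz, minpoly.aeval]
    have hne : (minpoly ℚ x * g).map (algebraMap ℚ ℂ) ≠ 0 := map_ne_zero hf
    rw [Polynomial.map_mul] at hne ⊢
    rw [rootMultiplicity_mul hne, rootMultiplicity_mul hne, hsimple x rfl, hsimple y hxy.symm,
      ih _ hlt g rfl]
  · rw [rootMultiplicity_eq_zero, rootMultiplicity_eq_zero]
    · rw [IsRoot.def, eval_map_algebraMap, ← minpoly.dvd_iff, ← hxy]
      exact hdvd
    · rw [IsRoot.def, eval_map_algebraMap, ← minpoly.dvd_iff]
      exact hdvd

/-- A root of a monic integral polynomial that is determined by its multiplicity is an integer. -/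
lemma exists_int_eq_of_rootMultiplicity {f : ℤ[X]} (hf : f.Monic) {x : ℂ}
    (hx : 0 < (f.map (algebraMap ℤ ℂ)).rootMultiplicity x)
    (h : ∀ y, (f.map (algebraMap ℤ ℂ)).rootMultiplicity x =
      (f.map (algebraMap ℤ ℂ)).rootMultiplicity y → x = y) : ∃ z : ℤ, x = z := by
  have hint : IsIntegral ℤ x := by
    refine ⟨f, hf, ?_⟩
    have := (rootMultiplicity_pos (hf.map (algebraMap ℤ ℂ)).ne_zero).mp hx
    rwa [IsRoot.def, eval_map] at this
  have hintQ : IsIntegral ℚ x := hint.tower_top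
  have hmap : f.map (algebraMap ℤ ℂ) = (f.map (algebraMap ℤ ℚ)).map (algebraMap ℚ ℂ) := by
    rw [Polynomial.map_map]
    congr 1
  have hbot : x ∈ (⊥ : Subalgebra ℚ ℂ) := by
    by_contra hc
    rw [notMem_iff_exists_ne_and_isConjRoot (minpoly.irreducible hintQ).separable
      (IsAlgClosed.splits _)] at hc
    obtain ⟨y, hne, hy⟩ := hc
    refine hne (h y ?_)
    rw [hmap]
    exact rootMultiplicity_eq_of_isConjRoot hintQ hy _
  obtain ⟨q, rfl⟩ := Algebra.mem_bot.mp hbot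
  rw [isIntegral_algebraMap_iff (algebraMap ℚ ℂ).injective] at hint
  obtain ⟨z, rfl⟩ := IsIntegrallyClosed.isIntegral_iff.mp hint
  exact ⟨z, by simp⟩

lemma IsCoherentConfiguration.exists_charpoly_eq_map {Ω ι : Type*} [Fintype Ω]
    [DecidableEq Ω] [Fintype ι] {A : ι → Matrix Ω Ω ℂ} (hA : IsCoherentConfiguration A) (i : ι) :
    ∃ f : ℤ[X], f.Monic ∧ (A i).charpoly = f.map (algebraMap ℤ ℂ) := by
  classical
  let N : Matrix Ω Ω ℤ := Matrix.of fun x y => if A i x y = 1 then 1 else 0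
  have hN : A i = N.map (algebraMap ℤ ℂ) := by
    ext x y
    rcases hA.zero_one i x y with h | h <;> simp [N, h]
  exact ⟨N.charpoly, N.charpoly_monic, by rw [hN, Matrix.charpoly_map]⟩

/-! ### The four characters of the configuration -/

open IsCoherentConfiguration (valency)
open IsSpectralDecomposition (idempotentRank)

lemma HasMultiplicities.rootMultiplicity_charpoly {Ω : Type*} [Fintype Ω] [DecidableEq Ω]
    {M : Matrix Ω Ω ℂ} {n : ℕ} {k r s t : ℂ} (h : HasMultiplicities M n k r s t) (z : ℂ) :
    M.charpoly.rootMultiplicity z = (if k = z then 1 else 0) + (if r = z then n else 0) +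
      (if s = z then n else 0) + if t = z then n - 1 else 0 := by
  have hlin : ∀ (w : ℂ) (e : ℕ), rootMultiplicity z ((X - C w) ^ e) = if w = z then e else 0 := by
    intro w e
    rw [← count_roots, roots_pow, roots_X_sub_C, Multiset.count_nsmul, Multiset.count_singleton]
    simp [eq_comm]
  have hne : ∀ (w : ℂ) (e : ℕ), (X - C w) ^ e ≠ 0 := fun w e => pow_ne_zero _ (X_sub_C_ne_zero w)
  have hk := hlin k 1
  have hk0 := hne k 1
  rw [pow_one] at hk hk0
  rw [h, rootMultiplicity_mul (by simp [hne, hk0]), rootMultiplicity_mul (by simp [hne, hk0]),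
    rootMultiplicity_mul (by simp [hne, hk0]), hlin, hlin, hlin, hk]

namespace IsCoherentConfiguration

variable {Ω : Type*} [Fintype Ω] [DecidableEq Ω] {A : Fin 4 → Matrix Ω Ω ℂ} {n : ℕ}

lemma connected_of_primitive (hA : IsCoherentConfiguration A) (hA0 : A 0 = 1)
    (hprim : IsPrimitiveConfiguration A) {i : Fin 4} (hi : i ≠ 0) :
    (relationGraph (A i)).Connected :=
  hprim i fun h => hi (hA.injective (h.trans hA0.symm))

lemma three_le (hA : IsCoherentConfiguration A) (hA0 : A 0 = 1)
    (hprim : IsPrimitiveConfiguration A) (hcard : Fintype.card Ω = 3 * n) : 3 ≤ n := by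
  have hsum := hA.sum_valency hA0
  rw [Fin.sum_univ_four, hA.valency_diagonal hA0, hcard] at hsum
  have h1 := hA.valency_pos hA0 1
  have h2 := hA.valency_pos hA0 2
  have h3 := hA.valency_pos hA0 3
  by_contra! hn
  have hne : ∀ i, i ≠ 0 → valency A i ≠ 1 := by
    intro i hi h
    have := hA.card_le_of_valency_eq_one hA0 (hA.connected_of_primitive hA0 hprim hi) h
    rw [hcard, Fintype.card_fin] at this
    omega
  have := hne 1 (by decide)
  have := hne 2 (by decide)
  have := hne 3 (by decide)
  omega

/-- The spectral decomposition can be numbered such that the principal character comes first and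
the characters have the multiplicities `1, n, n, n - 1`. -/
lemma exists_spectralDecomposition_of_multiplicities (hA : IsCoherentConfiguration A)
    (hA0 : A 0 = 1) (hprim : IsPrimitiveConfiguration A) (hcard : Fintype.card Ω = 3 * n)
    (hmult : ∀ i, i ≠ 0 → ∃ k r s t : ℂ, HasMultiplicities (A i) n k r s t) :
    ∃ E χ, IsSpectralDecomposition A E χ ∧ (∀ i, χ 0 i = valency A i) ∧
      Matrix.of (fun _ _ : Ω => (1 : ℂ)) = (Fintype.card Ω : ℂ) • E 0 ∧
      idempotentRank E 0 = 1 ∧ idempotentRank E 1 = n ∧ idempotentRank E 2 = n ∧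
      idempotentRank E 3 = n - 1 := by
  have hn := hA.three_le hA0 hprim hcard
  obtain ⟨E₀, χ₀, h₀⟩ := hA.exists_spectralDecomposition hA0 (hA.mul_comm_of_rank_four hA0)
  obtain ⟨b, hb1, hb2, hb3⟩ := h₀.exists_principal hA hA0
  obtain ⟨E, χ, h, hχ0, hm0, hJ⟩ : ∃ E χ, IsSpectralDecomposition A E χ ∧
      (∀ i, χ 0 i = valency A i) ∧ idempotentRank E 0 = 1 ∧
      Matrix.of (fun _ _ : Ω => (1 : ℂ)) = (Fintype.card Ω : ℂ) • E 0 := by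
    refine ⟨_, _, h₀.reindex (Equiv.swap 0 b), ?_, ?_, ?_⟩
    · simpa using hb1
    · change idempotentRank E₀ (Equiv.swap 0 b 0) = 1
      rw [Equiv.swap_apply_left, hb2]
    · simpa using hb3
  clear! E₀ χ₀ b
  have hroot := h.rootMultiplicity_charpoly hA0
  have hne : ∀ a, a ≠ 0 → ∀ i, i ≠ 0 → χ a i ≠ valency A i := fun a ha i hi =>
    h.ne_valency hA hA0 (hA.connected_of_primitive hA0 hprim hi) hJ ha
  have hsum : idempotentRank E 0 + idempotentRank E 1 + idempotentRank E 2 + idempotentRank E 3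
      = 3 * n := by
    have h1 := congrArg Matrix.trace (h.sum_eq_one hA0)
    rw [Matrix.trace_sum, Matrix.trace_one, Fin.sum_univ_four, hcard] at h1
    simp only [h.trace_eq_idempotentRank] at h1
    exact_mod_cast h1
  have key := multiplicities_of_characters hn (m := fun a => idempotentRank E a.succ)
    (χ := fun a i => χ a.succ i.succ) (fun a => h.idempotentRank_pos _)
    (by simp only [Fin.sum_univ_three]
        change idempotentRank E 1 + idempotentRank E 2 + idempotentRank E 3 = _
        omega)
    (fun a => by
      have h1 := h.sum_character_eq_zero hA hJ (Fin.succ_ne_zero a)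
      rw [Fin.sum_univ_succ, h.character_diagonal hA0] at h1
      linear_combination h1)
    (fun a b hab => by
      obtain ⟨i, hi⟩ := h.exists_ne (a := a.succ) (b := b.succ) (by simpa using hab)
      induction i using Fin.cases with
      | zero => exact absurd (by rw [h.character_diagonal hA0, h.character_diagonal hA0]) hi
      | succ i => exact ⟨i, hi⟩)
    (fun i => by
      obtain ⟨k, r, s, t, hm⟩ := hmult i.succ (Fin.succ_ne_zero i)
      have heq : ∀ z, (if (valency A i.succ : ℂ) = z then 1 else 0) +
          (∑ a : Fin 3, if χ a.succ i.succ = z then idempotentRank E a.succ else 0) =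
          (if k = z then 1 else 0) + (if r = z then n else 0) +
          (if s = z then n else 0) + if t = z then n - 1 else 0 := by
        intro z
        classical
        rw [← hm.rootMultiplicity_charpoly z, hroot, Finset.sum_filter,
          Fin.sum_univ_succ (fun a => if χ a i.succ = z then idempotentRank E a else 0), hχ0, hm0]
      -- the valency is a simple eigenvalue, hence it is `k`
      have hk := heq (valency A i.succ)
      rw [if_pos rfl, Finset.sum_eq_zero (fun a _ =>
        if_neg (hne a.succ (Fin.succ_ne_zero a) i.succ (Fin.succ_ne_zero i)))] at hk
      have hkv : k = valency A i.succ := by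
        by_contra hc
        rw [if_neg hc] at hk
        split_ifs at hk <;> omega
      refine ⟨r, s, t, fun z => ?_⟩
      have := heq z
      rw [hkv] at this
      simp only [add_assoc] at this ⊢
      exact Nat.add_left_cancel this)
  rcases key with ⟨h1, h2, h3⟩ | ⟨h1, h2, h3⟩ | ⟨h1, h2, h3⟩
  · exact ⟨E, χ, h, hχ0, hJ, hm0, h1, h2, h3⟩
  · refine ⟨_, _, h.reindex (Equiv.swap 2 3), ?_, ?_, ?_, ?_, ?_, ?_⟩
    · exact hχ0
    · exact hJ
    · exact hm0
    · exact h1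
    · exact h3
    · exact h2
  · refine ⟨_, _, h.reindex (Equiv.swap 1 3), ?_, ?_, ?_, ?_, ?_, ?_⟩
    · exact hχ0
    · exact hJ
    · exact hm0
    · exact h3
    · exact h2
    · exact h1

/-- The character of multiplicity `n - 1` takes integral values: they are determined by their
multiplicity as roots of the characteristic polynomials. -/
lemma exists_int_character (hA : IsCoherentConfiguration A) (hA0 : A 0 = 1) (hn : 3 ≤ n)
    {E : Fin 4 → Matrix Ω Ω ℂ} {χ : Fin 4 → Fin 4 → ℂ} (h : IsSpectralDecomposition A E χ)
    (hm0 : idempotentRank E 0 = 1) (hm1 : idempotentRank E 1 = n) (hm2 : idempotentRank E 2 = n)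
    (hm3 : idempotentRank E 3 = n - 1) {i : Fin 4} (hne : ∀ a, a ≠ 0 → χ a i ≠ χ 0 i) :
    ∃ z : ℤ, χ 3 i = z := by
  classical
  obtain ⟨f, hf, hfA⟩ := hA.exists_charpoly_eq_map i
  have hroot : ∀ z, (f.map (algebraMap ℤ ℂ)).rootMultiplicity z =
      (if χ 0 i = z then 1 else 0) + (if χ 1 i = z then n else 0) +
      (if χ 2 i = z then n else 0) + if χ 3 i = z then n - 1 else 0 := by
    intro z
    rw [← hfA, h.rootMultiplicity_charpoly hA0, Finset.sum_filter, Fin.sum_univ_four, hm0, hm1,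
      hm2, hm3]
  have h1 := hne 1 (by decide)
  have h2 := hne 2 (by decide)
  have h3 := hne 3 (by decide)
  refine exists_int_eq_of_rootMultiplicity hf ?_ ?_
  · rw [hroot, if_pos rfl]
    omega
  · intro y hy
    by_contra hc
    rw [hroot, hroot, if_neg h3.symm, if_pos rfl, if_neg hc] at hy
    by_cases hy0 : χ 0 i = y
    · rw [if_pos hy0, if_neg (fun h : χ 1 i = y => h1 (h.trans hy0.symm)),
        if_neg (fun h : χ 2 i = y => h2 (h.trans hy0.symm))] at hy
      omega
    · rw [if_neg hy0] at hy
      split_ifs at hy <;> omega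

end IsCoherentConfiguration

namespace IsSpectralDecomposition

variable {Ω : Type*} [Fintype Ω] [DecidableEq Ω] {A E : Fin 4 → Matrix Ω Ω ℂ} {n : ℕ}
  {χ : Fin 4 → Fin 4 → ℂ}

lemma isIntegral_character (h : IsSpectralDecomposition A E χ) (hA : IsCoherentConfiguration A)
    (hA0 : A 0 = 1) (a i : Fin 4) : IsIntegral ℤ (χ a i) := by
  classical
  obtain ⟨f, hf, hfA⟩ := hA.exists_charpoly_eq_map i
  refine ⟨f, hf, ?_⟩
  have h1 : 0 < (A i).charpoly.rootMultiplicity (χ a i) := by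
    rw [h.rootMultiplicity_charpoly hA0]
    exact Finset.sum_pos (fun b _ => h.idempotentRank_pos b) ⟨a, by simp⟩
  rw [rootMultiplicity_pos (Matrix.charpoly_monic _).ne_zero, hfA, IsRoot.def, eval_map] at h1
  exact h1

/-- The rational number `-(r + s + t) = (k - t) / n` is an algebraic integer. -/
lemma exists_valency_sub_eq (h : IsSpectralDecomposition A E χ) (hA : IsCoherentConfiguration A)
    (hA0 : A 0 = 1) (hn : n ≠ 0) {i : Fin 4} {z : ℤ} (hz : χ 3 i = z)
    (htr : (valency A i : ℂ) + n * χ 1 i + n * χ 2 i + (n - 1) * χ 3 i = 0) :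
    ∃ v : ℤ, (valency A i : ℤ) - z = n * v := by
  have hint : IsIntegral ℤ (-(χ 1 i + χ 2 i + χ 3 i)) :=
    (((h.isIntegral_character hA hA0 1 i).add (h.isIntegral_character hA hA0 2 i)).add
      (h.isIntegral_character hA hA0 3 i)).neg
  have hn' : (n : ℂ) ≠ 0 := by exact_mod_cast hn
  have hq : -(χ 1 i + χ 2 i + χ 3 i) = algebraMap ℚ ℂ (((valency A i : ℚ) - z) / n) := by
    simp only [map_div₀, map_sub, map_natCast, map_intCast]
    rw [eq_div_iff hn', ← hz]
    linear_combination -htr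
  rw [hq, isIntegral_algebraMap_iff (algebraMap ℚ ℂ).injective] at hint
  obtain ⟨v, hv⟩ := IsIntegrallyClosed.isIntegral_iff.mp hint
  refine ⟨v, ?_⟩
  have hnq : (n : ℚ) ≠ 0 := by exact_mod_cast hn
  rw [eq_div_iff hnq] at hv
  have : ((valency A i : ℚ) - z) = n * v := by
    rw [← hv]; simp [mul_comm]
  exact_mod_cast this

end IsSpectralDecomposition

/-! ### Arithmetic of the valencies -/

namespace IsCoherentConfiguration

variable {Ω : Type*} [Fintype Ω] [DecidableEq Ω] {A : Fin 4 → Matrix Ω Ω ℂ} {n : ℕ}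

lemma trace_cube (hA : IsCoherentConfiguration A) (hA0 : A 0 = 1) (i : Fin 4) :
    ∃ p : ℕ, (A i ^ 3).trace = p * (Fintype.card Ω * valency A i) := by
  obtain ⟨j, hj⟩ := hA.transpose i
  obtain ⟨p, hp⟩ := hA.mul i i
  refine ⟨p j, ?_⟩
  have hji : (A j).transpose = A i := by rw [← hj, Matrix.transpose_transpose]
  rw [pow_succ, pow_two, hp]
  nth_rewrite 1 [← hji]
  rw [hA.trace_sum_smul_mul_transpose hA0, hA.valency_eq_of_transpose hA0 hj]

/-- The spectral data of the configuration in terms of the valencies: the character of multiplicity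
`n - 1` takes the value `k - n` at a relation of valency `k`, and the valencies satisfy
`1 / k₁ + 1 / k₂ + 1 / k₃ = 3 / (n - 1)`. -/
lemma exists_eigenvalues (hA : IsCoherentConfiguration A)
    (hA0 : A 0 = 1) (hprim : IsPrimitiveConfiguration A) (hcard : Fintype.card Ω = 3 * n)
    (hmult : ∀ i, i ≠ 0 → ∃ k r s t : ℂ, HasMultiplicities (A i) n k r s t) :
    (3 * valency A 1 * valency A 2 * valency A 3 : ℤ) = (n - 1) * (valency A 1 * valency A 2 +
      valency A 1 * valency A 3 + valency A 2 * valency A 3) ∧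
    ∀ i, i ≠ 0 → ∃ r s : ℂ, r + s = n - 1 - valency A i ∧ ∀ e : ℕ, (A i ^ (e + 1)).trace =
      (valency A i : ℂ) ^ (e + 1) + n * (r ^ (e + 1) + s ^ (e + 1)) +
        (n - 1) * ((valency A i : ℂ) - n) ^ (e + 1) := by
  obtain ⟨E, χ, h, hχ0, hJ, hm0, hm1, hm2, hm3⟩ :=
    hA.exists_spectralDecomposition_of_multiplicities hA0 hprim hcard hmult
  have hn := hA.three_le hA0 hprim hcard
  have hn0 : (n : ℂ) ≠ 0 := by exact_mod_cast (by omega : n ≠ 0)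
  have hm3' : (idempotentRank E 3 : ℂ) = n - 1 := by
    rw [hm3, Nat.cast_sub (by omega), Nat.cast_one]
  have hpow : ∀ i (e : ℕ), (A i ^ (e + 1)).trace = (valency A i : ℂ) ^ (e + 1) +
      n * (χ 1 i ^ (e + 1) + χ 2 i ^ (e + 1)) + (n - 1) * χ 3 i ^ (e + 1) := by
    intro i e
    rw [h.trace_pow, Fin.sum_univ_four, hχ0, hm0, hm1, hm2, hm3']
    push_cast
    ring
  have htr : ∀ i, i ≠ 0 →
      (valency A i : ℂ) + n * χ 1 i + n * χ 2 i + (n - 1) * χ 3 i = 0 := by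
    intro i hi
    have h1 := hpow i 0
    simp only [zero_add, pow_one, hA.trace_eq_zero hA0 hi] at h1
    linear_combination -h1
  have hne : ∀ a, a ≠ 0 → ∀ i, i ≠ 0 → χ a i ≠ valency A i := fun a ha i hi =>
    h.ne_valency hA hA0 (hA.connected_of_primitive hA0 hprim hi) hJ ha
  choose! z hz using fun i (hi : i ≠ 0) => hA.exists_int_character hA0 hn h hm0 hm1 hm2 hm3
    (i := i) fun a ha => by rw [hχ0]; exact hne a ha i hi
  choose! v hv using fun i (hi : i ≠ 0) =>
    h.exists_valency_sub_eq hA hA0 (by omega : n ≠ 0) (hz i hi) (htr i hi)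
  have hnZ : (0 : ℤ) < n := by omega
  have hvpos : ∀ i, i ≠ 0 → 1 ≤ v i := by
    intro i hi
    have hle : (z i : ℝ) ≤ valency A i := h.le_valency hA hA0 (a := 3) (by rw [hz i hi]; simp)
    have hle' : z i ≤ valency A i := by exact_mod_cast hle
    have hlt : z i ≠ valency A i := fun hc => hne 3 (by decide) i hi (by
      rw [hz i hi, hc]; simp)
    have h1 : 0 < (n : ℤ) * v i := by rw [← hv i hi]; omega
    have := pos_of_mul_pos_right h1 hnZ.le
    omega
  have hsumk : (valency A 1 + valency A 2 + valency A 3 : ℤ) = 3 * n - 1 := by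
    have h1 := hA.sum_valency hA0
    rw [Fin.sum_univ_four, hA.valency_diagonal hA0, hcard] at h1
    omega
  have hsumz : z 1 + z 2 + z 3 = -1 := by
    have h1 := h.sum_character_eq_zero hA hJ (b := 3) (by decide)
    rw [Fin.sum_univ_four, h.character_diagonal hA0, hz 1 (by decide), hz 2 (by decide),
      hz 3 (by decide)] at h1
    have h2 : (1 + z 1 + z 2 + z 3 : ℤ) = 0 := by exact_mod_cast h1
    linarith
  -- the positive integers `v i` have sum `3`
  have hv1 : ∀ i, i ≠ 0 → v i = 1 := by
    have hsum : (n : ℤ) * (v 1 + v 2 + v 3) = n * 3 := by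
      rw [mul_add, mul_add, ← hv 1 (by decide), ← hv 2 (by decide), ← hv 3 (by decide)]
      linarith
    have h0 := mul_left_cancel₀ hnZ.ne' hsum
    have h1 := hvpos 1 (by decide)
    have h2 := hvpos 2 (by decide)
    have h3 := hvpos 3 (by decide)
    intro i hi
    fin_cases i
    · exact absurd rfl hi
    · change v 1 = 1; omega
    · change v 2 = 1; omega
    · change v 3 = 1; omega
  have ht : ∀ i, i ≠ 0 → χ 3 i = valency A i - n := by
    intro i hi
    have h1 := hv i hi
    rw [hv1 i hi] at h1
    rw [hz i hi, (by linarith : z i = valency A i - n)]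
    push_cast
    rfl
  refine ⟨?_, fun i hi => ⟨χ 1 i, χ 2 i, ?_, fun e => by rw [hpow, ht i hi]⟩⟩
  · -- compare traces in `E 3 * E 3 = E 3`, expanding one factor in the basis `A`
    obtain ⟨c, hc⟩ := h.mem_span 3
    have hcoeff : ∀ i, c i * (3 * n * valency A i) = χ 3 i * (n - 1) := by
      intro i
      obtain ⟨j, hj⟩ := hA.transpose i
      have h1 : (E 3 * (A i).transpose).trace = χ 3 j * (n - 1) := by
        rw [hj, h.mul_eq_smul', Matrix.trace_smul, h.trace_eq_idempotentRank, hm3', smul_eq_mul]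
      rw [hc, hA.trace_sum_smul_mul_transpose hA0, hcard] at h1
      have h2 : χ 3 j = χ 3 i := by
        rcases eq_or_ne i 0 with rfl | hi
        · rw [hA0, Matrix.transpose_one, ← hA0] at hj
          rw [hA.injective hj]
        · have hj0 : j ≠ 0 := by
            rintro rfl
            rw [hA0, Matrix.transpose_eq_one, ← hA0] at hj
            exact hi (hA.injective hj)
          rw [ht i hi, ht j hj0, hA.valency_eq_of_transpose hA0 hj]
      rw [h2] at h1
      rw [← h1]
      push_cast
      ring
    have hsum : ∑ i, c i * χ 3 i = 1 := by
      apply h.eq_of_smul_eq (a := 3)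
      rw [one_smul, Finset.sum_smul]
      nth_rewrite 2 [← h.mul_self 3]
      nth_rewrite 2 [hc]
      rw [Finset.sum_mul]
      exact Finset.sum_congr rfl fun i _ => by rw [Matrix.smul_mul, h.mul_eq_smul, smul_smul]
    rw [Fin.sum_univ_four] at hsum
    have e0 := hcoeff 0
    have e1 := hcoeff 1
    have e2 := hcoeff 2
    have e3 := hcoeff 3
    rw [h.character_diagonal hA0, ht 1 (by decide), ht 2 (by decide), ht 3 (by decide)] at hsum
    rw [h.character_diagonal hA0, hA.valency_diagonal hA0] at e0
    rw [ht 1 (by decide)] at e1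
    rw [ht 2 (by decide)] at e2
    rw [ht 3 (by decide)] at e3
    have hk : (valency A 1 : ℂ) + valency A 2 + valency A 3 = 3 * n - 1 := by
      exact_mod_cast congrArg (Int.cast : ℤ → ℂ) hsumk
    generalize hk1 : (valency A 1 : ℂ) = k₁ at *
    generalize hk2 : (valency A 2 : ℂ) = k₂ at *
    generalize hk3 : (valency A 3 : ℂ) = k₃ at *
    have hmain : (n : ℂ) ^ 2 * (3 * k₁ * k₂ * k₃) =
        n ^ 2 * ((n - 1) * (k₁ * k₂ + k₁ * k₃ + k₂ * k₃)) := by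
      linear_combination -(3 * n * (k₁ * k₂ * k₃)) * hsum + k₁ * k₂ * k₃ * e0
        + (k₁ - n) * k₂ * k₃ * e1 + (k₂ - n) * k₁ * k₃ * e2 + (k₃ - n) * k₁ * k₂ * e3
        + (n - 1) * (k₁ * k₂ * k₃) * hk
    have hfin := mul_left_cancel₀ (pow_ne_zero 2 hn0) hmain
    rw [← hk1, ← hk2, ← hk3] at hfin
    exact_mod_cast hfin
  · have h1 := htr i hi
    rw [ht i hi] at h1
    apply mul_left_cancel₀ hn0
    linear_combination h1

lemma hasRowSum (hA : IsCoherentConfiguration A) (hA0 : A 0 = 1) {i : Fin 4} {k : ℤ}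
    (h : (valency A i : ℤ) = k) : HasRowSum (A i) k := by
  intro x
  rw [hA.row_sum hA0, ← h, Int.cast_natCast]

end IsCoherentConfiguration

/-- Integrality of the intersection number `p` of a symmetric relation. -/
lemma integrality_of_symmetric {n x p : ℤ} {r s : ℂ} (hn : n ≠ 0) (hrs : r + s = -1 - x)
    (h2 : ((n : ℂ) + x) ^ 2 + n * (r ^ 2 + s ^ 2) + (n - 1) * x ^ 2 = 3 * n * (n + x))
    (h3 : ((n : ℂ) + x) ^ 3 + n * (r ^ 3 + s ^ 3) + (n - 1) * x ^ 3 = p * (3 * n * (n + x))) :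
    6 * (n + x) * p = 2 * n ^ 2 - 6 * n + 6 * x ^ 3 + 9 * x ^ 2 + 1 := by
  have hn' : (n : ℂ) ≠ 0 := by exact_mod_cast hn
  obtain rfl : s = -1 - x - r := by linear_combination hrs
  have h : (n : ℂ) * (6 * (n + x) * p) = n * (2 * n ^ 2 - 6 * n + 6 * x ^ 3 + 9 * x ^ 2 + 1) := by
    linear_combination (-2) * h3 + 3 * (-1 - (x : ℂ)) * h2
  exact_mod_cast mul_left_cancel₀ hn' h

/-- Integrality of the intersection number `p` of an antisymmetric relation. -/
lemma integrality_of_antisymmetric {n x p : ℤ} {r s : ℂ} (hx : n = 3 * x ^ 2 + 3 * x + 1)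
    (hn : n ≠ 0) (hk : n + x ≠ 0) (hrs : r + s = -1 - x)
    (h2 : ((n : ℂ) + x) ^ 2 + n * (r ^ 2 + s ^ 2) + (n - 1) * x ^ 2 = 0)
    (h3 : ((n : ℂ) + x) ^ 3 + n * (r ^ 3 + s ^ 3) + (n - 1) * x ^ 3 = p * (3 * n * (n + x))) :
    2 * p = (x + 2) * (2 * x + 1) := by
  have hne : (3 * n * (n + x) : ℂ) ≠ 0 := by
    exact_mod_cast mul_ne_zero (mul_ne_zero three_ne_zero hn) hk
  obtain rfl : s = -1 - x - r := by linear_combination hrs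
  have hx' : (n : ℂ) = 3 * x ^ 2 + 3 * x + 1 := by exact_mod_cast congrArg (Int.cast : ℤ → ℂ) hx
  have h : (3 * n * (n + x) : ℂ) * (2 * p) = (3 * n * (n + x)) * ((x + 2) * (2 * x + 1)) := by
    have : (3 * n * (n + x) : ℂ) * (2 * p) = 2 * ((n : ℂ) + x) ^ 3 + 2 * (n - 1) * x ^ 3
      - 3 * (-1 - (x : ℂ)) * (((n : ℂ) + x) ^ 2 + (n - 1) * x ^ 2) - n * (-1 - (x : ℂ)) ^ 3 := by
      linear_combination (-2) * h3 + 3 * (-1 - (x : ℂ)) * h2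
    rw [this, hx']
    ring
  exact_mod_cast mul_left_cancel₀ hne h

/-- The valencies `n + x`, `n + y`, `n + z` of three symmetric relations violate integrality. -/
lemma false_of_symmetric {n x y z p q r : ℤ} (hn : 3 ≤ n) (hs : x + y + z = -1)
    (hE : 3 * (n + x) * (n + y) * (n + z) =
      (n - 1) * ((n + x) * (n + y) + (n + x) * (n + z) + (n + y) * (n + z)))
    (hx0 : 0 < n + x) (hy0 : 0 < n + y) (hz0 : 0 < n + z)
    (hx : 6 * (n + x) * p = 2 * n ^ 2 - 6 * n + 6 * x ^ 3 + 9 * x ^ 2 + 1)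
    (hy : 6 * (n + y) * q = 2 * n ^ 2 - 6 * n + 6 * y ^ 3 + 9 * y ^ 2 + 1)
    (hz : 6 * (n + z) * r = 2 * n ^ 2 - 6 * n + 6 * z ^ 3 + 9 * z ^ 2 + 1) : False := by
  have hodd : ∀ {w e : ℤ}, 6 * (n + w) * e = 2 * n ^ 2 - 6 * n + 6 * w ^ 3 + 9 * w ^ 2 + 1 →
      ∃ u, w = 2 * u - 1 := by
    intro w e hw
    rcases Int.even_or_odd' w with ⟨u, rfl | rfl⟩
    · have : 2 * (3 * (n + 2 * u) * e - n ^ 2 + 3 * n - 24 * u ^ 3 - 18 * u ^ 2) = 1 := by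
        linear_combination hw
      omega
    · exact ⟨u + 1, by ring⟩
  obtain ⟨a, rfl⟩ := hodd hx
  obtain ⟨b, rfl⟩ := hodd hy
  obtain ⟨c, rfl⟩ := hodd hz
  obtain rfl : c = 1 - a - b := by omega
  have hE2 : (n - 1) ^ 2 + 4 * (n - 1) * (a * b + a * (1 - a - b) + b * (1 - a - b))
      + 12 * (a * b * (1 - a - b)) = 0 := by
    have : 2 * ((n - 1) ^ 2 + 4 * (n - 1) * (a * b + a * (1 - a - b) + b * (1 - a - b))
      + 12 * (a * b * (1 - a - b))) = 2 * 0 := by linear_combination hE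
    exact mul_left_cancel₀ two_ne_zero this
  obtain ⟨l, hl⟩ : ∃ l, n = 2 * l + 1 := by
    rcases Int.even_or_odd' n with ⟨l, rfl | rfl⟩
    · exfalso
      have : 2 * (2 * l ^ 2 - 2 * l + 2 * (2 * l - 1) *
          (a * b + a * (1 - a - b) + b * (1 - a - b)) + 6 * (a * b * (1 - a - b))) = -1 := by
        linear_combination hE2
      omega
    · exact ⟨l, rfl⟩
  subst hl
  refine false_of_integral_parameters (l := l) (u := a) (v := b) (w := 1 - a - b) (p := p) (q := q)
    (r := r) (by omega) (by ring) ?_ (by omega) (by omega) (by omega) ?_ ?_ ?_ <;>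
  apply mul_left_cancel₀ (four_ne_zero (α := ℤ))
  · linear_combination hE2
  · linear_combination hx
  · linear_combination hy
  · linear_combination hz

/-! ### The antisymmetric and the symmetric case -/

namespace IsCoherentConfiguration

variable {Ω : Type*} [Fintype Ω] [DecidableEq Ω] {A : Fin 4 → Matrix Ω Ω ℂ} {n : ℕ}

/-- A non-trivial involution of the four relations that fixes the diagonal swaps two of the others
and fixes the third. -/
lemma exists_perm_of_involution {τ : Fin 4 → Fin 4} (hτ : ∀ i, τ (τ i) = i) (h0 : τ 0 = 0)
    {i : Fin 4} (hi : τ i ≠ i) :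
    ∃ σ : Equiv.Perm (Fin 4), σ 0 = 0 ∧ τ (σ 3) = σ 2 := by
  have hi0 : i ≠ 0 := fun h => hi (by rw [h, h0])
  have hτ0 : τ i ≠ 0 := fun h => hi0 (by rw [← hτ i, h, h0])
  have key : ∀ a b : Fin 4, a ≠ 0 → b ≠ 0 → a ≠ b →
      ∃ σ : Equiv.Perm (Fin 4), σ 0 = 0 ∧ σ 3 = a ∧ σ 2 = b := by decide
  obtain ⟨σ, h1, h2, h3⟩ := key i (τ i) hi0 hτ0 hi.symm
  exact ⟨σ, h1, by rw [h2, h3]⟩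

lemma comp_perm (hA : IsCoherentConfiguration A) (σ : Equiv.Perm (Fin 4)) :
    IsCoherentConfiguration fun i => A (σ i) where
  zero_one i := hA.zero_one _
  ne_zero i := hA.ne_zero _
  sum_eq := (Equiv.sum_comp σ A).trans hA.sum_eq
  diagonal := by
    obtain ⟨S, hS⟩ := hA.diagonal
    refine ⟨S.map σ.symm.toEmbedding, ?_⟩
    rw [← hS, Finset.sum_map]
    simp
  transpose i := by
    obtain ⟨j, hj⟩ := hA.transpose (σ i)
    exact ⟨σ.symm j, by simpa using hj⟩
  mul i j := by
    obtain ⟨p, hp⟩ := hA.mul (σ i) (σ j)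
    exact ⟨fun k => p (σ k), hp.trans (Equiv.sum_comp σ fun k => (p k : ℂ) • A k).symm⟩

/-- With `x` the value of the character of multiplicity `n - 1` at the antisymmetric relations,
`n = 3 * x ^ 2 + 3 * x + 1`, and `x` is even by the integrality of an intersection number. -/
lemma exists_valencies_of_antisymmetric (hA : IsCoherentConfiguration A)
    (hA0 : A 0 = 1) (hprim : IsPrimitiveConfiguration A) (hcard : Fintype.card Ω = 3 * n)
    (hmult : ∀ i, i ≠ 0 → ∃ k r s t : ℂ, HasMultiplicities (A i) n k r s t)
    (h32 : (A 3).transpose = A 2) :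
    ∃ x : ℤ, Even x ∧ (n : ℤ) = 3 * x ^ 2 + 3 * x + 1 ∧ (valency A 1 : ℤ) = n - 1 - 2 * x ∧
      (valency A 2 : ℤ) = n + x ∧ (valency A 3 : ℤ) = n + x := by
  have hn := hA.three_le hA0 hprim hcard
  obtain ⟨hE, heig⟩ := hA.exists_eigenvalues hA0 hprim hcard hmult
  obtain ⟨r, s, hrs, htr⟩ := heig 3 (by decide)
  obtain ⟨p, hp⟩ := hA.trace_cube hA0 3
  have hv : valency A 2 = valency A 3 := hA.valency_eq_of_transpose hA0 h32
  have hpos := hA.valency_pos hA0 3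
  have hsum := hA.sum_valency hA0
  rw [Fin.sum_univ_four, hA.valency_diagonal hA0, hcard, hv] at hsum
  obtain ⟨x, hx⟩ : ∃ x : ℤ, (valency A 3 : ℤ) = n + x := ⟨valency A 3 - n, by ring⟩
  have hx1 : (valency A 1 : ℤ) = n - 1 - 2 * x := by omega
  have hxC : (valency A 3 : ℂ) = (n : ℤ) + x := by exact_mod_cast congrArg (Int.cast : ℤ → ℂ) hx
  have hnx : (n : ℤ) = 3 * x ^ 2 + 3 * x + 1 := by
    rw [hv, hx1, hx] at hE
    have hne : ((n : ℤ) + x) ≠ 0 := by rw [← hx]; exact_mod_cast hpos.ne'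
    have h2 : ((n : ℤ) + x) * n = (n + x) * (3 * x ^ 2 + 3 * x + 1) := by
      have : 2 * (((n : ℤ) + x) * n) = 2 * ((n + x) * (3 * x ^ 2 + 3 * x + 1)) := by
        linear_combination hE
      exact mul_left_cancel₀ two_ne_zero this
    exact mul_left_cancel₀ hne h2
  have hsq : (A 3 ^ 2).trace = 0 := by
    have h23 : (A 2).transpose = A 3 := by rw [← h32, Matrix.transpose_transpose]
    rw [pow_two]
    nth_rewrite 2 [← h23]
    exact hA.trace_mul_transpose_of_ne (by decide)
  have hparity := integrality_of_antisymmetric (n := n) (x := x) (p := p) (r := r) (s := s) hnx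
    (by omega) (by omega) (by rw [hrs, hxC]; push_cast; ring)
    (by
      have h1 := htr 1
      rw [hsq, hxC] at h1
      push_cast at h1 ⊢
      linear_combination -h1)
    (by
      have h1 := htr 2
      rw [hp, hxC, hcard] at h1
      push_cast at h1 ⊢
      linear_combination -h1)
  refine ⟨x, ?_, hnx, hx1, by rw [hv, hx], hx⟩
  rcases Int.even_or_odd' x with ⟨u, hu | hu⟩
  · exact ⟨u, by omega⟩
  · exfalso
    have : 2 * (p - 4 * u ^ 2 - 9 * u - 4) = (1 : ℤ) := by
      rw [hu] at hparity
      linear_combination hparity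
    omega

/-- Under the assumption on the multiplicities, some relation is not symmetric. -/
lemma false_of_isSymm (hA : IsCoherentConfiguration A)
    (hA0 : A 0 = 1) (hprim : IsPrimitiveConfiguration A) (hcard : Fintype.card Ω = 3 * n)
    (hmult : ∀ i, i ≠ 0 → ∃ k r s t : ℂ, HasMultiplicities (A i) n k r s t)
    (hsymm : ∀ i, (A i).transpose = A i) : False := by
  have hn := hA.three_le hA0 hprim hcard
  obtain ⟨hE, heig⟩ := hA.exists_eigenvalues hA0 hprim hcard hmult
  have hsum := hA.sum_valency hA0
  rw [Fin.sum_univ_four, hA.valency_diagonal hA0, hcard] at hsum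
  have hint : ∀ i, i ≠ 0 → ∃ p : ℤ, 6 * ((n : ℤ) + (valency A i - n)) * p =
      2 * (n : ℤ) ^ 2 - 6 * n + 6 * ((valency A i : ℤ) - n) ^ 3
        + 9 * ((valency A i : ℤ) - n) ^ 2 + 1 := by
    intro i hi
    obtain ⟨r, s, hrs, htr⟩ := heig i hi
    obtain ⟨p, hp⟩ := hA.trace_cube hA0 i
    have hsq : (A i ^ 2).trace = 3 * n * valency A i := by
      rw [pow_two]
      nth_rewrite 2 [← hsymm i]
      rw [hA.trace_mul_transpose_self hA0, hcard]
      push_cast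
      rfl
    refine ⟨p, integrality_of_symmetric (n := n) (x := valency A i - n) (r := r) (s := s)
      (by omega) (by rw [hrs]; push_cast; ring) ?_ ?_⟩
    · have h1 := htr 1
      rw [hsq] at h1
      push_cast at h1 ⊢
      linear_combination -h1
    · have h1 := htr 2
      rw [hp, hcard] at h1
      push_cast at h1 ⊢
      linear_combination -h1
  obtain ⟨p, hp⟩ := hint 1 (by decide)
  obtain ⟨q, hq⟩ := hint 2 (by decide)
  obtain ⟨r, hr⟩ := hint 3 (by decide)
  have h1 := hA.valency_pos hA0 1
  have h2 := hA.valency_pos hA0 2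
  have h3 := hA.valency_pos hA0 3
  refine false_of_symmetric (n := n) (by omega) (by omega) ?_ (by omega) (by omega) (by omega)
    hp hq hr
  linear_combination hE

end IsCoherentConfiguration

theorem mainTheorem4 {Ω : Type*} [Fintype Ω] [DecidableEq Ω] (n : ℕ)
    (hcard : Fintype.card Ω = 3 * n)
    (A : Fin 4 → Matrix Ω Ω ℂ)
    (hA : IsCoherentConfiguration A)
    (hA0 : A 0 = 1)
    (hprim : IsPrimitiveConfiguration A)
    (hmult : ∀ i, i ≠ 0 → ∃ k r s t : ℂ, HasMultiplicities (A i) n k r s t) :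
    ∃ σ : Equiv.Perm (Fin 4), σ 0 = 0 ∧ ∃ a : ℕ, n = 3 * a ^ 2 + 3 * a + 1 ∧
      ((Even a ∧ A (σ 2) = (A (σ 3)).transpose ∧
          HasRowSum (A (σ 1)) ((n : ℤ) - 2 * a - 1) ∧
          HasRowSum (A (σ 2)) ((n : ℤ) + a) ∧
          HasRowSum (A (σ 3)) ((n : ℤ) + a)) ∨
       (Odd a ∧ A (σ 2) = (A (σ 3)).transpose ∧
          HasRowSum (A (σ 1)) ((n : ℤ) + 2 * a + 1) ∧
          HasRowSum (A (σ 2)) ((n : ℤ) - a - 1) ∧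
          HasRowSum (A (σ 3)) ((n : ℤ) - a - 1)) ∨
       ((∀ i, (A i).IsSymm) ∧
          HasRowSum (A (σ 1)) ((n : ℤ) + 2 * a + 1) ∧
          HasRowSum (A (σ 2)) ((n : ℤ) - a - 1) ∧
          HasRowSum (A (σ 3)) ((n : ℤ) - a - 1))) := by
  by_cases hsymm : ∀ i, (A i).transpose = A i
  · exact (hA.false_of_isSymm hA0 hprim hcard hmult hsymm).elim
  push Not at hsymm
  obtain ⟨i, hi⟩ := hsymm
  choose τ hτ using hA.transpose
  have hinv : ∀ i, τ (τ i) = i := fun i => hA.injective (by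
    rw [← hτ, ← hτ, Matrix.transpose_transpose])
  have hτ0 : τ 0 = 0 := hA.injective (by rw [← hτ, hA0, Matrix.transpose_one])
  obtain ⟨σ, hσ0, hσ⟩ := IsCoherentConfiguration.exists_perm_of_involution hinv hτ0
    (i := i) fun h => hi (by rw [hτ, h])
  have hB := hA.comp_perm σ
  have hB0 : A (σ 0) = 1 := by rw [hσ0, hA0]
  have h32 : (A (σ 3)).transpose = A (σ 2) := by rw [hτ, hσ]
  obtain ⟨x, hx, hn, h1, h2, h3⟩ := hB.exists_valencies_of_antisymmetric hB0
    (fun i => hprim (σ i)) hcard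
    (fun i hi => hmult (σ i) fun h => hi (σ.injective (h.trans hσ0.symm))) h32
  refine ⟨σ, hσ0, ?_⟩
  rcases le_or_gt 0 x with h0 | h0
  · obtain ⟨a, rfl⟩ := Int.eq_ofNat_of_zero_le h0
    refine ⟨a, by exact_mod_cast hn, Or.inl ⟨by exact_mod_cast hx, h32.symm, ?_, ?_, ?_⟩⟩
    · exact hB.hasRowSum hB0 (i := 1) (by omega)
    · exact hB.hasRowSum hB0 (i := 2) h2
    · exact hB.hasRowSum hB0 (i := 3) h3
  · obtain ⟨a, ha⟩ := Int.eq_ofNat_of_zero_le (show 0 ≤ -x - 1 by omega)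
    obtain rfl : x = -a - 1 := by omega
    refine ⟨a, ?_, Or.inr (Or.inl ⟨?_, h32.symm, ?_, ?_, ?_⟩)⟩
    · have : (n : ℤ) = 3 * a ^ 2 + 3 * a + 1 := by rw [hn]; ring
      exact_mod_cast this
    · obtain ⟨u, hu⟩ := hx
      exact ⟨(-u - 1).toNat, by omega⟩
    · exact hB.hasRowSum hB0 (i := 1) (by omega)
    · exact hB.hasRowSum hB0 (i := 2) (by omega)
    · exact hB.hasRowSum hB0 (i := 3) (by omega)
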